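/- All codes are binary linear codes. For a singly even self-dual code $C$ (that is, $C=C^\perp$ and some codeword has weight $\equiv 2 \pmod 4$), let $C_0$ be the set of codewords of weight divisible by $4$ and let $S=C_0^\perp\setminus C$ be the shadow of $C$. If the length is $\equiv 2\pmod 8$, then $C$ is said to have minimal shadow if $S$ has minimum weight $1$. Let $m\ge 1$ be an integer. Call a pair $(W,S)$ of polynomials in $\mathbb{Q}[y]$ an enumerator pair for $m$ if there are $c_0,\dots,c_{3m+1}\in\mathbb{Q}$ such that $$W=\sum_{i=0}^{12m+5}a_iy^{2i}=\sum_{j=0}^{3m+1}c_j(1+y^2)^{12m+5-4j}\bigl(y^2(1-y^2)^2\bigr)^j,$$ $$S=\sum_{i=0}^{6m+2}b_iy^{4i+1}=\sum_{j=0}^{3m+1}(-1)^jc_j2^{12m+5-6j}y^{12m+5-4j}(1-y^4)^{2j},$$ and $a_0=1$, $a_1=\dots=a_{2m}=0$, $b_0=1$, $b_i=0$ for $1\le i\le m-1$, and $a_{2m+1}=b_m$. Theorem. For every $m\ge1$ there is exactly one enumerator pair $(W_m,S_m)$ for $m$. If $C$ is a singly even self-dual $[24m+10,12m+5,4m+2]$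 code with minimal shadow, then the weight enumerators of $C$ and of its shadow are $W_m$ and $S_m$, respectively. All coefficients of $W_m$ and $S_m$ are nonnegative integers if and only if $1\le m\le159$. In particular, for $m\ge160$ there is no singly even self-dual $[24m+10,12m+5,4m+2]$ code with minimal shadow. -/

import Mathlib

open Polynomial

namespace BinaryCode

/-- Binary words of length `n`; a (linear) code of length `n` is a subspace of this space. -/
abbrev Word (n : ℕ) : Type := Fin n → ZMod 2

/-- The dual `{x | x ⬝ y = 0 for all y ∈ s}` of a set of binary words. -/
def dual {n : ℕ} (s : Set (Word n)) : Submodule (ZMod 2) (Word n) where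
  carrier := {x | ∀ y ∈ s, x ⬝ᵥ y = 0}
  zero_mem' := fun y _ => zero_dotProduct y
  add_mem' := fun {a b} ha hb y hy => by
    rw [add_dotProduct, ha y hy, hb y hy, add_zero]
  smul_mem' := fun c x hx y hy => by
    rw [smul_dotProduct, hx y hy, smul_zero]

/-- A self-dual code `C = C^⊥` is singly even if some codeword has weight `≡ 2 (mod 4)`. -/
def IsSinglyEvenSelfDual {n : ℕ} (C : Submodule (ZMod 2) (Word n)) : Prop :=
  C = dual (C : Set (Word n)) ∧ ∃ x ∈ C, hammingNorm x % 4 = 2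

/-- `C_0`, the codewords of weight divisible by four. -/
def doublyEvenPart {n : ℕ} (C : Submodule (ZMod 2) (Word n)) : Set (Word n) :=
  {x | x ∈ C ∧ 4 ∣ hammingNorm x}

/-- The shadow `C_0^⊥ \ C`. -/
def shadow {n : ℕ} (C : Submodule (ZMod 2) (Word n)) : Set (Word n) :=
  (dual (doublyEvenPart C) : Set (Word n)) \ (C : Set (Word n))

/-- `d` is the minimum weight of the set `s`: the least weight of a nonzero word in `s`. -/
def IsMinWeight {n : ℕ} (s : Set (Word n)) (d : ℕ) : Prop :=
  IsLeast {w | ∃ x ∈ s, x ≠ 0 ∧ hammingNorm x = w} d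

/-- `C` is an `[n, k, d]` code. -/
def HasParameters {n : ℕ} (C : Submodule (ZMod 2) (Word n)) (k d : ℕ) : Prop :=
  Module.finrank (ZMod 2) C = k ∧ IsMinWeight (C : Set (Word n)) d

/-- The value `4, 1, 2, 3` for even `n ≡ 0, 2, 4, 6 (mod 8)`. -/
def minimalShadowWeight (n : ℕ) : ℕ := if n % 8 = 0 then 4 else n % 8 / 2

/-- A singly even self-dual code has minimal shadow if the minimum weight of the shadow is
`4, 1, 2, 3` according as `n ≡ 0, 2, 4, 6 (mod 8)`. -/
def HasMinimalShadow {n : ℕ} (C : Submodule (ZMod 2) (Word n)) : Prop :=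
  IsMinWeight (shadow C) (minimalShadowWeight n)

open Classical in
/-- The weight enumerator `∑_{x ∈ s} y^{wt x}` of a set of words. -/
noncomputable def weightEnumerator {n : ℕ} (s : Set (Word n)) : ℚ[X] :=
  ∑ x : Word n with x ∈ s, X ^ hammingNorm x

/-- For even `n`, the common form of the weight enumerators of a singly even self-dual code of
length `n` (the polynomial `W`) and of its shadow (the polynomial `S`):
`W = ∑_j c_j (1+y²)^{n/2-4j} (y²(1-y²)²)^j` and
`S = ∑_j (-1)^j c_j 2^{n/2-6j} y^{n/2-4j} (1-y⁴)^{2j}`, where `0 ≤ j ≤ ⌊n/8⌋`. -/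
def IsGleasonPair (n : ℕ) (W S : ℚ[X]) : Prop :=
  ∃ c : ℕ → ℚ,
    W = ∑ j ∈ Finset.range (n / 8 + 1),
      C (c j) * (1 + X ^ 2) ^ (n / 2 - 4 * j) * (X ^ 2 * (1 - X ^ 2) ^ 2) ^ j ∧
    S = ∑ j ∈ Finset.range (n / 8 + 1),
      C ((-1) ^ j * c j * (2 : ℚ) ^ (((n / 2 : ℕ) : ℤ) - 6 * (j : ℤ))) *
        X ^ (n / 2 - 4 * j) * (1 - X ^ 4) ^ (2 * j)

/-- `(W, S)` is the pair of (formal) weight enumerators of a singly even self-dual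
`[24m+10, 12m+5, 4m+2]` code with minimal shadow and of its shadow (`m ≥ 1`). Writing
`W = ∑ a_i y^{2i}` and `S = ∑ b_i y^{4i+1}`, the conditions are the form above,
`a_0 = 1`, `a_1 = ⋯ = a_{2m} = 0`, `b_0 = 1`, `b_1 = ⋯ = b_{m-1} = 0` and `a_{2m+1} = b_m`.
No code is required to exist. -/
def IsEnumeratorPair (m : ℕ) (W S : ℚ[X]) : Prop :=
  IsGleasonPair (24 * m + 10) W S ∧
  W.coeff 0 = 1 ∧ (∀ i, 1 ≤ i → i ≤ 2 * m → W.coeff (2 * i) = 0) ∧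
  S.coeff 1 = 1 ∧ (∀ i, 1 ≤ i → i ≤ m - 1 → S.coeff (4 * i + 1) = 0) ∧
  W.coeff (2 * (2 * m + 1)) = S.coeff (4 * m + 1)

/-- All coefficients are nonnegative integers. -/
def HasNonnegIntegerCoeffs (P : ℚ[X]) : Prop := ∀ i, ∃ k : ℕ, P.coeff i = (k : ℚ)

/-- A singly even self-dual `[24m+10, 12m+5, 4m+2]` code with minimal shadow. -/
def IsMinimalShadowCode (m : ℕ) (C : Submodule (ZMod 2) (Word (24 * m + 10))) : Prop :=
  IsSinglyEvenSelfDual C ∧ HasParameters C (12 * m + 5) (4 * m + 2) ∧ HasMinimalShadow C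

end BinaryCode

/-! Put `z = y²` in the weight enumerator and use `y⁴` as the variable of the shadow enumerator
divided by `y`. The `j`-th Gleason term then starts at degree `j`, and the `j`-th shadow term at
degree `3m+1-j`. So `a_0, …, a_{2m}` determine `c_0, …, c_{2m}`, while `b_0, …, b_{m-1}` determine
`c_{3m+1}, …, c_{2m+2}`. In the homogeneous system the remaining condition reads `c_{2m+1} =
-c_{2m+1}/2`. The linear system is therefore square and injective, which gives existence and
uniqueness (`eq_zero_of_homogeneous`, `exists_isNormalized`).

For an actual code, the MacWilliams identity and repeated division by the invariant `z(1-z)²` give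
Gleason's form, and the character `(-1)^(wt/2)` of `C` gives the form of the shadow. A weight-one
vector `e` of the shadow then does the rest: `x ↦ x + e` exchanges code and shadow, which forces the
vanishing of the `b_i` and the equality `a_{2m+1} = b_m` (`IsMinimalShadowCode.isEnumeratorPair`).

For `m ≥ 160` the coefficient `a_{2m+4}` is negative. Lagrange inversion expresses each `c_{2m+r}`
in two ways, once through `W` and once through `S`. Equating them for `r = 1, 2, 3, 4` yields
`a_{2m+1}, …, a_{2m+4}` in turn as a common positive factor times a polynomial in `m`. The last
polynomial is `fourthCoefficient`, which is negative from 160 on.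

For `m ≤ 159` nonnegativity and integrality are verified numerically. Candidate integer coefficient
lists are computed, both polynomials are evaluated at a large power of two, and their coefficients
are read off as digits (`exists_isNormalized_of_checkLists`). By uniqueness this is the pair in
question. -/

namespace BinaryCode

/-! ### The triangular linear system for the Gleason coefficients -/

/-- The summand of the common form of the weight enumerators, in the variable `z = y²`. -/
noncomputable def gleasonTerm (k j : ℕ) : ℚ[X] :=
  (1 + X) ^ (k - 4 * j) * (X * (1 - X) ^ 2) ^ j

/-- The weight enumerator with Gleason coefficients `c`, in the variable `z = y²`. -/
noncomputable def gleasonPoly (k N : ℕ) (c : ℕ → ℚ) : ℚ[X] :=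
  ∑ j ∈ Finset.range N, C (c j) * gleasonTerm k j

/-- The summand of the common form of the shadow enumerators, in the variable `y⁴`. -/
noncomputable def shadowTerm (J j : ℕ) : ℚ[X] := X ^ (J - j) * ((1 - X) ^ 2) ^ j

/-- The factor relating the coefficients of a weight enumerator to those of the shadow. -/
noncomputable def shadowScale (k j : ℕ) : ℚ := (-1) ^ j * (2 : ℚ) ^ ((k : ℤ) - 6 * (j : ℤ))

/-- The shadow enumerator, divided by `y` and in the variable `y⁴`. -/
noncomputable def shadowPoly (k J : ℕ) (c : ℕ → ℚ) : ℚ[X] :=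
  ∑ j ∈ Finset.range (J + 1), C (shadowScale k j * c j) * shadowTerm J j

theorem shadowScale_ne_zero (k j : ℕ) : shadowScale k j ≠ 0 :=
  mul_ne_zero (pow_ne_zero _ (by norm_num)) (zpow_ne_zero _ (by norm_num))

theorem expand_gleasonPoly (k N : ℕ) (c : ℕ → ℚ) :
    expand ℚ 2 (gleasonPoly k N c) =
      ∑ j ∈ Finset.range N, C (c j) * (1 + X ^ 2) ^ (k - 4 * j) * (X ^ 2 * (1 - X ^ 2) ^ 2) ^ j := by
  simp [gleasonPoly, gleasonTerm, mul_assoc]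

theorem X_mul_expand_shadowPoly (J : ℕ) (c : ℕ → ℚ) :
    X * expand ℚ 4 (shadowPoly (4 * J + 1) J c) =
      ∑ j ∈ Finset.range (J + 1),
        C ((-1) ^ j * c j * (2 : ℚ) ^ (((4 * J + 1 : ℕ) : ℤ) - 6 * (j : ℤ))) *
          X ^ (4 * J + 1 - 4 * j) * (1 - X ^ 4) ^ (2 * j) := by
  rw [shadowPoly, map_sum, Finset.mul_sum]
  refine Finset.sum_congr rfl fun j hj => ?_
  have hj' : j ≤ J := Nat.lt_succ_iff.mp (Finset.mem_range.mp hj)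
  have h1 : 4 * J + 1 - 4 * j = 4 * (J - j) + 1 := by omega
  have h2 : (-1) ^ j * c j * (2 : ℚ) ^ (((4 * J + 1 : ℕ) : ℤ) - 6 * (j : ℤ)) =
      shadowScale (4 * J + 1) j * c j := by
    rw [shadowScale]; ring
  rw [h1, h2]
  simp only [shadowTerm, map_mul, expand_C, map_pow, expand_X, map_sub, map_one]
  rw [← pow_mul, ← pow_mul]
  ring

/-- The linear conditions on Gleason coefficients that define an enumerator pair. -/
def IsNormalized (m : ℕ) (c : ℕ → ℚ) : Prop :=
  (gleasonPoly (12 * m + 5) (3 * m + 2) c).coeff 0 = 1 ∧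
  (∀ i, 1 ≤ i → i ≤ 2 * m → (gleasonPoly (12 * m + 5) (3 * m + 2) c).coeff i = 0) ∧
  (shadowPoly (12 * m + 5) (3 * m + 1) c).coeff 0 = 1 ∧
  (∀ i, 1 ≤ i → i ≤ m - 1 → (shadowPoly (12 * m + 5) (3 * m + 1) c).coeff i = 0) ∧
  (gleasonPoly (12 * m + 5) (3 * m + 2) c).coeff (2 * m + 1) =
    (shadowPoly (12 * m + 5) (3 * m + 1) c).coeff m

theorem coeff_expand_two (P : ℚ[X]) (i : ℕ) : (expand ℚ 2 P).coeff (2 * i) = P.coeff i := by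
  rw [mul_comm, coeff_expand_mul (by norm_num)]

theorem coeff_X_mul_expand_four (P : ℚ[X]) (i : ℕ) :
    (X * expand ℚ 4 P).coeff (4 * i + 1) = P.coeff i := by
  rw [coeff_X_mul, mul_comm, coeff_expand_mul (by norm_num)]

theorem isEnumeratorPair_iff (m : ℕ) (W S : ℚ[X]) :
    IsEnumeratorPair m W S ↔ ∃ c : ℕ → ℚ, IsNormalized m c ∧
      W = expand ℚ 2 (gleasonPoly (12 * m + 5) (3 * m + 2) c) ∧
      S = X * expand ℚ 4 (shadowPoly (12 * m + 5) (3 * m + 1) c) := by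
  have h1 : (24 * m + 10) / 2 = 12 * m + 5 := by omega
  have h2 : (24 * m + 10) / 8 + 1 = 3 * m + 2 := by omega
  have h3 : 12 * m + 5 = 4 * (3 * m + 1) + 1 := by ring
  have key : IsGleasonPair (24 * m + 10) W S ↔ ∃ c : ℕ → ℚ,
      W = expand ℚ 2 (gleasonPoly (12 * m + 5) (3 * m + 2) c) ∧
      S = X * expand ℚ 4 (shadowPoly (12 * m + 5) (3 * m + 1) c) := by
    unfold IsGleasonPair
    refine exists_congr fun c => ?_
    rw [h1, h2, expand_gleasonPoly, h3, X_mul_expand_shadowPoly]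
  have cW : ∀ P : ℚ[X], (expand ℚ 2 P).coeff 0 = P.coeff 0 := fun P => coeff_expand_two P 0
  have cS : ∀ P : ℚ[X], (X * expand ℚ 4 P).coeff 1 = P.coeff 0 :=
    fun P => coeff_X_mul_expand_four P 0
  rw [IsEnumeratorPair, key]
  constructor
  · rintro ⟨⟨c, rfl, rfl⟩, h⟩
    refine ⟨c, ?_, rfl, rfl⟩
    simpa only [IsNormalized, coeff_expand_two, coeff_X_mul_expand_four, cW, cS] using h
  · rintro ⟨c, h, rfl, rfl⟩
    refine ⟨⟨c, rfl, rfl⟩, ?_⟩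
    simpa only [IsNormalized, coeff_expand_two, coeff_X_mul_expand_four, cW, cS] using h

theorem coeff_gleasonTerm_of_lt {k j i : ℕ} (h : i < j) : (gleasonTerm k j).coeff i = 0 := by
  rw [gleasonTerm, mul_pow, mul_left_comm, coeff_X_pow_mul', if_neg (by omega)]

theorem coeff_gleasonTerm_self (k j : ℕ) : (gleasonTerm k j).coeff j = 1 := by
  rw [gleasonTerm, mul_pow, mul_left_comm, coeff_X_pow_mul', if_pos le_rfl, Nat.sub_self]
  simp [coeff_zero_eq_eval_zero]

theorem coeff_shadowTerm_of_lt {J j i : ℕ} (h : i < J - j) : (shadowTerm J j).coeff i = 0 := by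
  rw [shadowTerm, coeff_X_pow_mul', if_neg (by omega)]

theorem coeff_shadowTerm_self (J j : ℕ) : (shadowTerm J j).coeff (J - j) = 1 := by
  rw [shadowTerm, coeff_X_pow_mul', if_pos le_rfl, Nat.sub_self]
  simp [coeff_zero_eq_eval_zero]

theorem coeff_gleasonPoly (k N i : ℕ) (c : ℕ → ℚ) :
    (gleasonPoly k N c).coeff i = ∑ j ∈ Finset.range N, c j * (gleasonTerm k j).coeff i := by
  simp [gleasonPoly]

theorem coeff_shadowPoly (k J i : ℕ) (c : ℕ → ℚ) :
    (shadowPoly k J c).coeff i =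
      ∑ j ∈ Finset.range (J + 1), shadowScale k j * c j * (shadowTerm J j).coeff i := by
  simp [shadowPoly, mul_assoc]

/-- If all earlier coefficients vanish, the `i`-th coefficient is the `i`-th Gleason coefficient. -/
theorem coeff_gleasonPoly_of_forall_lt {k N i : ℕ} {c : ℕ → ℚ} (hi : i < N)
    (h : ∀ j < i, c j = 0) : (gleasonPoly k N c).coeff i = c i := by
  rw [coeff_gleasonPoly, Finset.sum_eq_single i]
  · rw [coeff_gleasonTerm_self, mul_one]
  · intro j _ hji
    rcases lt_or_gt_of_ne hji with h' | h'
    · rw [h j h', zero_mul]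
    · rw [coeff_gleasonTerm_of_lt h', mul_zero]
  · intro h'; exact absurd (Finset.mem_range.mpr hi) h'

theorem coeff_shadowPoly_of_forall_gt {k J i : ℕ} {c : ℕ → ℚ} (hi : i ≤ J)
    (h : ∀ j ≤ J, J - i < j → c j = 0) :
    (shadowPoly k J c).coeff i = shadowScale k (J - i) * c (J - i) := by
  rw [coeff_shadowPoly, Finset.sum_eq_single (J - i)]
  · have := coeff_shadowTerm_self J (J - i)
    rw [Nat.sub_sub_self hi] at this
    rw [this, mul_one]
  · intro j hj hji
    have hj' := Finset.mem_range.mp hj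
    rcases lt_or_gt_of_ne hji with h' | h'
    · rw [coeff_shadowTerm_of_lt (by omega), mul_zero]
    · rw [h j (by omega) h', mul_zero, zero_mul]
  · intro h'; exact absurd (Finset.mem_range.mpr (by omega)) h'

/-- Gleason coefficients satisfying the homogeneous conditions vanish. -/
theorem eq_zero_of_homogeneous {m : ℕ} {c : ℕ → ℚ}
    (hW : ∀ i ≤ 2 * m, (gleasonPoly (12 * m + 5) (3 * m + 2) c).coeff i = 0)
    (hS : ∀ i < m, (shadowPoly (12 * m + 5) (3 * m + 1) c).coeff i = 0)
    (hWS : (gleasonPoly (12 * m + 5) (3 * m + 2) c).coeff (2 * m + 1) =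
      (shadowPoly (12 * m + 5) (3 * m + 1) c).coeff m) :
    ∀ j < 3 * m + 2, c j = 0 := by
  -- Gleason terms start at degree `j` with coefficient 1: the system is triangular from below.
  have low : ∀ j, j ≤ 2 * m → c j = 0 := by
    intro j
    induction j using Nat.strong_induction_on with
    | _ j ih =>
      intro hj
      rw [← coeff_gleasonPoly_of_forall_lt (k := 12 * m + 5) (N := 3 * m + 2) (by omega)
        fun i hi => ih i hi (by omega)]
      exact hW j hj
  -- Shadow terms start at degree `3m+1-j`: the system is triangular from above.
  have high : ∀ i, i < m → c (3 * m + 1 - i) = 0 := by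
    intro i
    induction i using Nat.strong_induction_on with
    | _ i ih =>
      intro hi
      have h := coeff_shadowPoly_of_forall_gt (k := 12 * m + 5) (J := 3 * m + 1) (i := i) (c := c)
        (by omega) (fun j hj hij => by
          have := ih (3 * m + 1 - j) (by omega) (by omega)
          rwa [Nat.sub_sub_self hj] at this)
      rw [hS i hi] at h
      exact (mul_eq_zero.mp h.symm).resolve_left (shadowScale_ne_zero _ _)
  have high' : ∀ j, 2 * m + 1 < j → j ≤ 3 * m + 1 → c j = 0 := fun j h1 h2 => by
    have := high (3 * m + 1 - j) (by omega)
    rwa [Nat.sub_sub_self h2] at this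
  -- Only `c_{2m+1}` is left, and its shadow factor is `(-1)^(2m+1) 2^(-1)`, so the last condition
  -- is `c = -c/2`.
  have mid : c (2 * m + 1) = 0 := by
    have e : 3 * m + 1 - m = 2 * m + 1 := by omega
    rw [coeff_gleasonPoly_of_forall_lt (by omega) fun j hj => low j (by omega),
      coeff_shadowPoly_of_forall_gt (by omega) fun j hj hj' => high' j (by omega) hj, e,
      shadowScale, show ((12 * m + 5 : ℕ) : ℤ) - 6 * ((2 * m + 1 : ℕ) : ℤ) = -1 by push_cast; ring,
      Odd.neg_one_pow ⟨m, rfl⟩] at hWS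
    norm_num at hWS
    linarith
  intro j hj
  rcases lt_trichotomy j (2 * m + 1) with h | h | h
  · exact low j (by omega)
  · rw [h]; exact mid
  · exact high' j h (by omega)

theorem gleasonPoly_sub (k N : ℕ) (c c' : ℕ → ℚ) :
    gleasonPoly k N (c - c') = gleasonPoly k N c - gleasonPoly k N c' := by
  simp [gleasonPoly, sub_mul]

theorem shadowPoly_sub (k J : ℕ) (c c' : ℕ → ℚ) :
    shadowPoly k J (c - c') = shadowPoly k J c - shadowPoly k J c' := by
  simp [shadowPoly, sub_mul, mul_sub]

theorem IsNormalized.eq {m : ℕ} {c c' : ℕ → ℚ} (h : IsNormalized m c)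
    (h' : IsNormalized m c') : ∀ j < 3 * m + 2, c j = c' j := by
  obtain ⟨h0, h1, h2, h3, h4⟩ := h
  obtain ⟨h0', h1', h2', h3', h4'⟩ := h'
  intro j hj
  refine sub_eq_zero.mp (eq_zero_of_homogeneous (m := m) (c := c - c') ?_ ?_ ?_ j hj)
  · intro i hi
    rw [gleasonPoly_sub, coeff_sub]
    rcases Nat.eq_zero_or_pos i with rfl | hi'
    · rw [h0, h0', sub_self]
    · rw [h1 i hi' hi, h1' i hi' hi, sub_self]
  · intro i hi
    rw [shadowPoly_sub, coeff_sub]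
    rcases Nat.eq_zero_or_pos i with rfl | hi'
    · rw [h2, h2', sub_self]
    · rw [h3 i hi' (by omega), h3' i hi' (by omega), sub_self]
  · rw [gleasonPoly_sub, coeff_sub, shadowPoly_sub, coeff_sub, h4, h4']

theorem gleasonPoly_congr {k N : ℕ} {c c' : ℕ → ℚ} (h : ∀ j < N, c j = c' j) :
    gleasonPoly k N c = gleasonPoly k N c' :=
  Finset.sum_congr rfl fun j hj => by rw [h j (Finset.mem_range.mp hj)]

theorem shadowPoly_congr {k J : ℕ} {c c' : ℕ → ℚ} (h : ∀ j < J + 1, c j = c' j) :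
    shadowPoly k J c = shadowPoly k J c' :=
  Finset.sum_congr rfl fun j hj => by rw [h j (Finset.mem_range.mp hj)]

theorem IsEnumeratorPair.unique {m : ℕ} {W S W' S' : ℚ[X]} (h : IsEnumeratorPair m W S)
    (h' : IsEnumeratorPair m W' S') : W' = W ∧ S' = S := by
  obtain ⟨c, hc, rfl, rfl⟩ := (isEnumeratorPair_iff m W S).mp h
  obtain ⟨c', hc', rfl, rfl⟩ := (isEnumeratorPair_iff m W' S').mp h'
  exact ⟨by rw [gleasonPoly_congr (hc'.eq hc)], by rw [shadowPoly_congr (hc'.eq hc)]⟩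

/-- The conditions on the Gleason coefficients as one linear map: the coefficients `a₀, …, a_{2m}`,
then `b₀, …, b_{m-1}`, then `a_{2m+1} - b_m`. -/
noncomputable def conditionMatrix (m : ℕ) : Matrix (Fin (3 * m + 2)) (Fin (3 * m + 2)) ℚ :=
  fun i j =>
    if i.1 ≤ 2 * m then (gleasonTerm (12 * m + 5) j).coeff i
    else if i.1 ≤ 3 * m then
      shadowScale (12 * m + 5) j * (shadowTerm (3 * m + 1) j).coeff (i - (2 * m + 1))
    else (gleasonTerm (12 * m + 5) j).coeff (2 * m + 1) -
      shadowScale (12 * m + 5) j * (shadowTerm (3 * m + 1) j).coeff m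

theorem conditionMatrix_mulVec (m : ℕ) (c : ℕ → ℚ) (i : Fin (3 * m + 2)) :
    (conditionMatrix m).mulVec (fun j => c j) i =
      if i.1 ≤ 2 * m then (gleasonPoly (12 * m + 5) (3 * m + 2) c).coeff i
      else if i.1 ≤ 3 * m then
        (shadowPoly (12 * m + 5) (3 * m + 1) c).coeff (i - (2 * m + 1))
      else (gleasonPoly (12 * m + 5) (3 * m + 2) c).coeff (2 * m + 1) -
        (shadowPoly (12 * m + 5) (3 * m + 1) c).coeff m := by
  simp only [Matrix.mulVec, dotProduct, conditionMatrix, coeff_gleasonPoly, coeff_shadowPoly,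
    Finset.sum_range]
  split_ifs
  · exact Finset.sum_congr rfl fun j _ => mul_comm _ _
  · exact Finset.sum_congr rfl fun j _ => by ring
  · rw [← Finset.sum_sub_distrib]
    exact Finset.sum_congr rfl fun j _ => by ring

theorem conditionMatrix_injective (m : ℕ) :
    Function.Injective (Matrix.mulVecLin (conditionMatrix m)) := by
  rw [← LinearMap.ker_eq_bot, LinearMap.ker_eq_bot']
  intro v hv
  set c : ℕ → ℚ := fun j => if h : j < 3 * m + 2 then v ⟨j, h⟩ else 0 with hc
  have hvc : (fun j : Fin (3 * m + 2) => c j) = v := by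
    funext j; simp [hc]
  have key : ∀ i : Fin (3 * m + 2), (conditionMatrix m).mulVec (fun j => c j) i = 0 := fun i => by
    rw [hvc]; exact congrFun hv i
  have := eq_zero_of_homogeneous (m := m) (c := c) ?_ ?_ ?_
  · rw [← hvc]; funext j; exact this j j.2
  · intro i hi
    have := key ⟨i, by omega⟩
    rwa [conditionMatrix_mulVec, if_pos hi] at this
  · intro i hi
    have := key ⟨2 * m + 1 + i, by omega⟩
    rwa [conditionMatrix_mulVec, if_neg (by simp; omega), if_pos (by simp; omega),
      Nat.add_sub_cancel_left] at this
  · have := key ⟨3 * m + 1, by omega⟩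
    rw [conditionMatrix_mulVec, if_neg (by simp; omega), if_neg (by simp)] at this
    exact sub_eq_zero.mp this

/-- There are as many conditions as unknowns, so injectivity of the homogeneous system gives
solvability. -/
theorem exists_isNormalized {m : ℕ} (hm : 1 ≤ m) : ∃ c : ℕ → ℚ, IsNormalized m c := by
  obtain ⟨v, hv⟩ := LinearMap.injective_iff_surjective.mp (conditionMatrix_injective m)
    -- Rows `0` and `2m+1` carry the conditions `a_0 = 1` and `b_0 = 1`.
    (fun i => if i.1 = 0 ∨ i.1 = 2 * m + 1 then 1 else 0)
  set c : ℕ → ℚ := fun j => if h : j < 3 * m + 2 then v ⟨j, h⟩ else 0 with hc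
  have hvc : (fun j : Fin (3 * m + 2) => c j) = v := by
    funext j; simp [hc]
  have key : ∀ i : Fin (3 * m + 2), (conditionMatrix m).mulVec (fun j => c j) i =
      if i.1 = 0 ∨ i.1 = 2 * m + 1 then 1 else 0 := fun i => by
    rw [hvc]; exact congrFun hv i
  have low : ∀ i, i ≤ 2 * m → (gleasonPoly (12 * m + 5) (3 * m + 2) c).coeff i =
      if i = 0 then 1 else 0 := by
    intro i hi
    have := key ⟨i, by omega⟩
    rw [conditionMatrix_mulVec, if_pos hi] at this
    rw [this]
    exact if_congr (by simp; omega) rfl rfl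
  have high : ∀ i, i < m → (shadowPoly (12 * m + 5) (3 * m + 1) c).coeff i =
      if i = 0 then 1 else 0 := by
    intro i hi
    have := key ⟨2 * m + 1 + i, by omega⟩
    rw [conditionMatrix_mulVec, if_neg (by simp; omega), if_pos (by simp; omega),
      Nat.add_sub_cancel_left] at this
    rw [this]
    exact if_congr (by simp) rfl rfl
  refine ⟨c, ?_, ?_, ?_, ?_, ?_⟩
  · rw [low 0 (by omega), if_pos rfl]
  · intro i h1 h2; rw [low i h2, if_neg (by omega)]
  · rw [high 0 (by omega), if_pos rfl]
  · intro i h1 h2; rw [high i (by omega), if_neg (by omega)]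
  · have := key ⟨3 * m + 1, by omega⟩
    rw [conditionMatrix_mulVec, if_neg (by simp; omega), if_neg (by simp),
      if_neg (by simp; omega)] at this
    exact sub_eq_zero.mp this

-- Lagrange inversion: kernels extracting the Gleason coefficients

local notation "𝔵" => (PowerSeries.X : PowerSeries ℚ)

local notation "𝔲" => ((1 + PowerSeries.X)⁻¹ : PowerSeries ℚ)

local notation "𝔳" => ((1 - PowerSeries.X)⁻¹ : PowerSeries ℚ)

theorem one_add_X_mul_inv : (1 + 𝔵) * 𝔲 = 1 := PowerSeries.mul_inv_cancel _ (by simp)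

theorem one_sub_X_mul_inv : (1 - 𝔵) * 𝔳 = 1 := PowerSeries.mul_inv_cancel _ (by simp)

/-- The residue of a derivative vanishes. With `φ = x(1-x)²/(1+x)⁴`, the series `h` is `x^s φ^(-s)`,
and `1-6x+x²` is the numerator of the logarithmic derivative `xφ'/φ = (1-6x+x²)/(1-x²)`. -/
theorem coeff_residue_weight {s : ℕ} (hs : 1 ≤ s) :
    PowerSeries.coeff s ((1 + 𝔵) ^ (4 * s - 1) * 𝔳 ^ (2 * s + 1) * (1 - 6 * 𝔵 + 𝔵 ^ 2)) = 0 := by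
  obtain ⟨t, rfl⟩ : ∃ t, s = t + 1 := ⟨s - 1, by omega⟩
  set h : PowerSeries ℚ := (1 + 𝔵) ^ (4 * (t + 1)) * 𝔳 ^ (2 * (t + 1)) with hh
  have key : ((t + 1 : ℕ) : PowerSeries ℚ) * h - 𝔵 * PowerSeries.derivative ℚ h =
      ((t + 1 : ℕ) : PowerSeries ℚ) * ((1 + 𝔵) ^ (4 * (t + 1) - 1) * 𝔳 ^ (2 * (t + 1) + 1) *
        (1 - 6 * 𝔵 + 𝔵 ^ 2)) := by
    have e1 : 4 * (t + 1) - 1 = 4 * t + 3 := by omega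
    have e2 : 2 * (t + 1) - 1 = 2 * t + 1 := by omega
    rw [hh, Derivation.leibniz, PowerSeries.derivative_pow, PowerSeries.derivative_pow,
      PowerSeries.derivative_inv', e1, e2]
    simp only [map_add, map_sub, PowerSeries.derivative_one, PowerSeries.derivative_X, smul_eq_mul]
    push_cast
    have hv := one_sub_X_mul_inv
    generalize 𝔳 = v at hv
    have h1 : v ^ (2 * (t + 1)) = v ^ (2 * (t + 1) + 1) * (1 - 𝔵) := by
      rw [pow_succ, mul_assoc, mul_comm v, hv, mul_one]
    rw [h1]
    ring
  -- The operator `s - x d/dx` kills the coefficient of `x^s`.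
  have h0 : PowerSeries.coeff (t + 1) (((t + 1 : ℕ) : PowerSeries ℚ) * h -
      𝔵 * PowerSeries.derivative ℚ h) = 0 := by
    rw [map_sub, PowerSeries.coeff_succ_X_mul, PowerSeries.coeff_derivative,
      ← map_natCast (PowerSeries.C (R := ℚ)) (t + 1), PowerSeries.coeff_C_mul]
    push_cast; ring
  rw [key, ← map_natCast (PowerSeries.C (R := ℚ)) (t + 1), PowerSeries.coeff_C_mul] at h0
  exact (mul_eq_zero.mp h0).resolve_left (by positivity)

/-- The same argument with `ψ = x/(1-x)²`, for which `xψ'/ψ = (1+x)/(1-x)`. -/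
theorem coeff_residue_shadow {s : ℕ} (hs : 1 ≤ s) :
    PowerSeries.coeff s ((1 + 𝔵) * (1 - 𝔵) ^ (2 * s - 1)) = 0 := by
  obtain ⟨t, rfl⟩ : ∃ t, s = t + 1 := ⟨s - 1, by omega⟩
  set h : PowerSeries ℚ := (1 - 𝔵) ^ (2 * (t + 1)) with hh
  have key : ((t + 1 : ℕ) : PowerSeries ℚ) * h - 𝔵 * PowerSeries.derivative ℚ h =
      ((t + 1 : ℕ) : PowerSeries ℚ) * ((1 + 𝔵) * (1 - 𝔵) ^ (2 * (t + 1) - 1)) := by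
    have e2 : 2 * (t + 1) - 1 = 2 * t + 1 := by omega
    rw [hh, PowerSeries.derivative_pow, e2]
    simp only [map_sub, PowerSeries.derivative_one, PowerSeries.derivative_X]
    push_cast
    ring
  have h0 : PowerSeries.coeff (t + 1) (((t + 1 : ℕ) : PowerSeries ℚ) * h -
      𝔵 * PowerSeries.derivative ℚ h) = 0 := by
    rw [map_sub, PowerSeries.coeff_succ_X_mul, PowerSeries.coeff_derivative,
      ← map_natCast (PowerSeries.C (R := ℚ)) (t + 1), PowerSeries.coeff_C_mul]
    push_cast; ring
  rw [key, ← map_natCast (PowerSeries.C (R := ℚ)) (t + 1), PowerSeries.coeff_C_mul] at h0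
  exact (mul_eq_zero.mp h0).resolve_left (by positivity)

/-- The kernel whose pairing with a weight enumerator yields a Gleason coefficient. -/
noncomputable def weightKernel (p j : ℕ) : PowerSeries ℚ :=
  𝔲 ^ p * 𝔳 ^ (2 * j + 1) * (1 - 6 * 𝔵 + 𝔵 ^ 2)

/-- For `i < j` the product is `x^i` times the series of `coeff_residue_weight` with `s = j - i`;
for `i > j` its order exceeds `j`. Thus the kernels are dual to the Gleason terms. -/
theorem coeff_gleasonTerm_mul_weightKernel {k p i j : ℕ} (hp : 1 ≤ p) (hpj : p + 4 * j = k + 1) :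
    PowerSeries.coeff j ((gleasonTerm k i : PowerSeries ℚ) * weightKernel p j) =
      if i = j then 1 else 0 := by
  have hu := one_add_X_mul_inv
  have hv := one_sub_X_mul_inv
  have e : (gleasonTerm k i : PowerSeries ℚ) * weightKernel p j =
      𝔵 ^ i * ((1 + 𝔵) ^ (k - 4 * i) * (1 - 𝔵) ^ (2 * i) * weightKernel p j) := by
    simp only [gleasonTerm, Polynomial.coe_mul, Polynomial.coe_pow, Polynomial.coe_add,
      Polynomial.coe_sub, Polynomial.coe_one, Polynomial.coe_X]
    rw [mul_pow, ← pow_mul]; ring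
  rw [e, PowerSeries.coeff_X_pow_mul']
  rcases lt_trichotomy i j with h | rfl | h
  · obtain ⟨s, rfl⟩ : ∃ s, j = i + s := ⟨j - i, by omega⟩
    rw [if_pos h.le, if_neg h.ne, Nat.add_sub_cancel_left,
      ← coeff_residue_weight (s := s) (by omega), weightKernel]
    congr 1
    have e1 : k - 4 * i = (4 * s - 1) + p := by omega
    have e2 : 2 * (i + s) + 1 = 2 * i + (2 * s + 1) := by omega
    generalize 𝔲 = u at hu ⊢
    generalize 𝔳 = v at hv ⊢
    have hu' : (1 + 𝔵) ^ p * u ^ p = 1 := by rw [← mul_pow, hu, one_pow]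
    have hv' : (1 - 𝔵) ^ (2 * i) * v ^ (2 * i) = 1 := by rw [← mul_pow, hv, one_pow]
    rw [e1, e2, pow_add, pow_add]
    calc _ = ((1 + 𝔵) ^ p * u ^ p) * ((1 - 𝔵) ^ (2 * i) * v ^ (2 * i)) *
          ((1 + 𝔵) ^ (4 * s - 1) * v ^ (2 * s + 1) * (1 - 6 * 𝔵 + 𝔵 ^ 2)) := by ring
      _ = _ := by rw [hu', hv', one_mul, one_mul]
  · rw [if_pos le_rfl, if_pos rfl, Nat.sub_self]
    simp [weightKernel]
  · rw [if_neg (by omega), if_neg (by omega)]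

theorem coeff_gleasonPoly_mul_weightKernel {k N p j : ℕ} (c : ℕ → ℚ) (hp : 1 ≤ p)
    (hpj : p + 4 * j = k + 1) (hj : j < N) :
    PowerSeries.coeff j ((gleasonPoly k N c : PowerSeries ℚ) * weightKernel p j) = c j := by
  have : (gleasonPoly k N c : PowerSeries ℚ) =
      ∑ i ∈ Finset.range N, PowerSeries.C (c i) * (gleasonTerm k i : PowerSeries ℚ) := by
    rw [gleasonPoly, ← Polynomial.coeToPowerSeries.ringHom_apply, map_sum]
    simp
  rw [this, Finset.sum_mul, map_sum, Finset.sum_eq_single j]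
  · rw [mul_assoc, PowerSeries.coeff_C_mul, coeff_gleasonTerm_mul_weightKernel hp hpj, if_pos rfl,
      mul_one]
  · intro i _ hij
    rw [mul_assoc, PowerSeries.coeff_C_mul, coeff_gleasonTerm_mul_weightKernel hp hpj, if_neg hij,
      mul_zero]
  · intro h; exact absurd (Finset.mem_range.mpr hj) h

theorem coeff_shadowTerm_mul_kernel {J i j : ℕ} (hi : i ≤ J) (hj : j ≤ J) :
    PowerSeries.coeff (J - j) ((shadowTerm J i : PowerSeries ℚ) * ((1 + 𝔵) * 𝔳 ^ (2 * j + 1))) =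
      if i = j then 1 else 0 := by
  have hv := one_sub_X_mul_inv
  have e : (shadowTerm J i : PowerSeries ℚ) * ((1 + 𝔵) * 𝔳 ^ (2 * j + 1)) =
      𝔵 ^ (J - i) * ((1 - 𝔵) ^ (2 * i) * ((1 + 𝔵) * 𝔳 ^ (2 * j + 1))) := by
    simp only [shadowTerm, Polynomial.coe_mul, Polynomial.coe_pow,
      Polynomial.coe_sub, Polynomial.coe_one, Polynomial.coe_X]
    rw [← pow_mul]; ring
  rw [e, PowerSeries.coeff_X_pow_mul']
  rcases lt_trichotomy j i with h | rfl | h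
  · obtain ⟨s, rfl⟩ : ∃ s, i = j + s := ⟨i - j, by omega⟩
    have e0 : J - j - (J - (j + s)) = s := by omega
    rw [if_pos (by omega), if_neg h.ne', e0, ← coeff_residue_shadow (s := s) (by omega)]
    congr 1
    have e1 : 2 * (j + s) = (2 * s - 1) + (2 * j + 1) := by omega
    generalize 𝔳 = v at hv ⊢
    have hv' : (1 - 𝔵) ^ (2 * j + 1) * v ^ (2 * j + 1) = 1 := by rw [← mul_pow, hv, one_pow]
    rw [e1, pow_add]
    calc _ = ((1 - 𝔵) ^ (2 * j + 1) * v ^ (2 * j + 1)) *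
          ((1 + 𝔵) * (1 - 𝔵) ^ (2 * s - 1)) := by ring
      _ = _ := by rw [hv', one_mul]
  · rw [if_pos le_rfl, if_pos rfl, Nat.sub_self]
    simp
  · rw [if_neg (by omega), if_neg (by omega)]

theorem coeff_shadowPoly_mul_kernel {k J j : ℕ} (c : ℕ → ℚ) (hj : j ≤ J) :
    PowerSeries.coeff (J - j)
      ((shadowPoly k J c : PowerSeries ℚ) * ((1 + 𝔵) * 𝔳 ^ (2 * j + 1))) =
      shadowScale k j * c j := by
  have : (shadowPoly k J c : PowerSeries ℚ) = ∑ i ∈ Finset.range (J + 1),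
      PowerSeries.C (shadowScale k i * c i) * (shadowTerm J i : PowerSeries ℚ) := by
    rw [shadowPoly, ← Polynomial.coeToPowerSeries.ringHom_apply, map_sum]
    simp only [map_mul, Polynomial.coeToPowerSeries.ringHom_apply, Polynomial.coe_C]
  rw [this, Finset.sum_mul, map_sum, Finset.sum_eq_single j]
  · rw [mul_assoc, PowerSeries.coeff_C_mul, coeff_shadowTerm_mul_kernel hj hj, if_pos rfl,
      mul_one]
  · intro i hi hij
    rw [mul_assoc, PowerSeries.coeff_C_mul,
      coeff_shadowTerm_mul_kernel (Nat.lt_succ_iff.mp (Finset.mem_range.mp hi)) hj, if_neg hij,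
      mul_zero]
  · intro h; exact absurd (Finset.mem_range.mpr (Nat.lt_succ_iff.mpr hj)) h

/-! ### Binomial expansions of the kernels -/

theorem inv_one_sub_X_eq_mk : 𝔳 = PowerSeries.mk 1 := by
  rw [eq_comm, PowerSeries.eq_inv_iff_mul_eq_one (by simp)]
  exact PowerSeries.mk_one_mul_one_sub_eq_one ℚ

theorem coeff_inv_one_sub_X_pow (d n : ℕ) :
    PowerSeries.coeff n (𝔳 ^ (d + 1)) = ((d + n).choose d : ℚ) := by
  rw [inv_one_sub_X_eq_mk, PowerSeries.mk_one_pow_eq_mk_choose_add, PowerSeries.coeff_mk]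

theorem inv_mul_inv_eq_expand : 𝔲 * 𝔳 = PowerSeries.expand 2 two_ne_zero 𝔳 := by
  have h := congrArg (PowerSeries.expand 2 two_ne_zero) one_sub_X_mul_inv
  rw [map_mul, map_sub, map_one, PowerSeries.expand_X] at h
  have hu := one_add_X_mul_inv
  have hv := one_sub_X_mul_inv
  generalize PowerSeries.expand 2 two_ne_zero 𝔳 = w at h ⊢
  generalize 𝔲 = u at hu ⊢
  generalize 𝔳 = v at hv ⊢
  linear_combination (w * (1 - 𝔵) * v) * hu + w * hv - u * v * h

theorem coeff_inv_mul_inv_pow_two_mul (d n : ℕ) :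
    PowerSeries.coeff (2 * n) ((𝔲 * 𝔳) ^ (d + 1)) = ((d + n).choose d : ℚ) := by
  rw [inv_mul_inv_eq_expand, ← map_pow, PowerSeries.coeff_expand_mul, coeff_inv_one_sub_X_pow]

theorem coeff_inv_mul_inv_pow_odd (d n : ℕ) :
    PowerSeries.coeff (2 * n + 1) ((𝔲 * 𝔳) ^ d) = 0 := by
  rw [inv_mul_inv_eq_expand, ← map_pow, PowerSeries.coeff_expand_of_not_dvd]
  omega




theorem coeff_mul_of_gap (W K : PowerSeries ℚ) (M r : ℕ) (h0 : PowerSeries.coeff 0 W = 1)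
    (h : ∀ i, 1 ≤ i → i ≤ M → PowerSeries.coeff i W = 0) :
    PowerSeries.coeff (M + r) (W * K) = PowerSeries.coeff (M + r) K +
      ∑ s ∈ Finset.range r,
        PowerSeries.coeff (M + 1 + s) W * PowerSeries.coeff (r - 1 - s) K := by
  rw [PowerSeries.coeff_mul, Finset.Nat.sum_antidiagonal_eq_sum_range_succ_mk,
    show (M + r).succ = (M + 1) + r by omega, Finset.sum_range_add, Finset.sum_range_succ']
  simp only [h0, one_mul, Nat.sub_zero]
  rw [Finset.sum_eq_zero fun i hi => by
    rw [h (i + 1) (by omega) (by have := Finset.mem_range.mp hi; omega), zero_mul], zero_add]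
  congr 1
  refine Finset.sum_congr rfl fun s _ => ?_
  rw [show M + r - (M + 1 + s) = r - 1 - s by omega]

/-- The power of `1/(1-x²)` has even exponents only, so just the coefficients of `Q` of the parity
`e` contribute. -/
theorem coeff_inv_mul_inv_pow_mul (d M e D : ℕ) (he : e ≤ 1) (Q : ℚ[X])
    (hQ : ∀ s, 2 * D + e ≤ s → Q.coeff s = 0) (hD : D ≤ M) :
    PowerSeries.coeff (2 * M + e) ((𝔲 * 𝔳) ^ (d + 1) * (Q : PowerSeries ℚ)) =
      ∑ t ∈ Finset.range D, Q.coeff (2 * t + e) * ((d + (M - t)).choose d : ℚ) := by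
  rw [mul_comm ((𝔲 * 𝔳) ^ (d + 1)), PowerSeries.coeff_mul, Finset.Nat.sum_antidiagonal_eq_sum_range_succ_mk, eq_comm]
  refine Finset.sum_of_injOn (fun t => 2 * t + e) (fun a _ b _ hab => by simpa using hab)
    (fun t ht => by simp at ht ⊢; omega) ?_ ?_
  · intro s hs hs'
    simp only [Set.mem_image, Finset.coe_range, Set.mem_Iio, not_exists, not_and,
      Finset.mem_range] at hs hs'
    rw [Polynomial.coeff_coe]
    by_cases hsD : 2 * D + e ≤ s
    · rw [hQ s hsD, zero_mul]
    · have h1 : 2 * M + e - s = 2 * ((2 * M + e - s) / 2) + 1 := by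
        by_contra hne
        exact hs' ((s - e) / 2) (by omega) (by omega)
      rw [h1, coeff_inv_mul_inv_pow_odd, mul_zero]
  · intro t ht
    have := Finset.mem_range.mp ht
    rw [Polynomial.coeff_coe, show 2 * M + e - (2 * t + e) = 2 * (M - t) by omega,
      coeff_inv_mul_inv_pow_two_mul]

/-- The polynomial factor of the weight kernel at `j = 2m + r`, with `N = 6r - 5`. -/
noncomputable def kernelPoly (N : ℕ) : ℚ[X] := (1 + X) ^ N * (1 - 6 * X + X ^ 2)

theorem kernelPoly_coeff_zero (N : ℕ) : (kernelPoly N).coeff 0 = 1 := by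
  simp [kernelPoly, coeff_zero_eq_eval_zero]

theorem kernelPoly_eq (N : ℕ) :
    kernelPoly N = (1 + X) ^ N - C 6 * (X * (1 + X) ^ N) + X * (X * (1 + X) ^ N) := by
  rw [kernelPoly, show (C 6 : ℚ[X]) = 6 from rfl]; ring

theorem kernelPoly_coeff_one (N : ℕ) : (kernelPoly N).coeff 1 = N - 6 := by
  rw [kernelPoly_eq, coeff_add, coeff_sub, coeff_C_mul, coeff_X_mul, coeff_X_mul,
    coeff_one_add_X_pow, coeff_one_add_X_pow, mul_coeff_zero]
  simp

theorem kernelPoly_coeff_add_two (N s : ℕ) :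
    (kernelPoly N).coeff (s + 2) =
      (N.choose (s + 2) : ℚ) - 6 * N.choose (s + 1) + N.choose s := by
  rw [kernelPoly_eq, coeff_add, coeff_sub, coeff_C_mul, coeff_X_mul, coeff_X_mul, coeff_X_mul,
    coeff_one_add_X_pow, coeff_one_add_X_pow, coeff_one_add_X_pow]

theorem kernelPoly_coeff_of_lt {N s : ℕ} (h : N + 2 < s) : (kernelPoly N).coeff s = 0 := by
  obtain ⟨t, rfl⟩ : ∃ t, s = t + 2 := ⟨s - 2, by omega⟩
  rw [kernelPoly_coeff_add_two, Nat.choose_eq_zero_of_lt (by omega),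
    Nat.choose_eq_zero_of_lt (by omega), Nat.choose_eq_zero_of_lt (by omega)]
  simp

/-- Extending the fraction by `(1+x)^N` turns its denominator into a power of `1-x²`, at the price
of a polynomial numerator. -/
theorem weightKernel_eq_mul_kernelPoly (p N j : ℕ) (h : p + N = 2 * j + 1) :
    weightKernel p j = (𝔲 * 𝔳) ^ (2 * j + 1) * (kernelPoly N : PowerSeries ℚ) := by
  have e : (kernelPoly N : PowerSeries ℚ) = (1 + 𝔵) ^ N * (1 - 6 * 𝔵 + 𝔵 ^ 2) := by
    rw [kernelPoly_eq]
    simp only [Polynomial.coe_mul, Polynomial.coe_pow, Polynomial.coe_add,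
      Polynomial.coe_sub, Polynomial.coe_one, Polynomial.coe_X, Polynomial.coe_C]
    rw [map_ofNat]; ring
  have hu := one_add_X_mul_inv
  have hu' : (1 + 𝔵) ^ N * 𝔲 ^ N = 1 := by rw [← mul_pow, hu, one_pow]
  rw [weightKernel, e, ← h, mul_pow, pow_add 𝔲]
  generalize 𝔲 = u at hu' ⊢
  linear_combination (-(u ^ p * 𝔳 ^ (p + N) * (1 - 6 * 𝔵 + 𝔵 ^ 2))) * hu'

/-- The initial coefficients of the weight kernel. -/
theorem weightKernel_coeffs (p N j : ℕ) (h : p + 1 + (N + 1) = 2 * j + 1) :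
    PowerSeries.coeff 0 (weightKernel (p + 1) j) = 1 ∧
    PowerSeries.coeff 1 (weightKernel (p + 1) j) = (N : ℚ) - 5 ∧
    PowerSeries.coeff 2 (weightKernel (p + 1) j) =
      ((N + 2).choose N : ℚ) - 6 * (N + 1) + 1 + (p + 1) ∧
    PowerSeries.coeff 3 (weightKernel (p + 1) j) =
      ((N + 3).choose N : ℚ) - 6 * (N + 2).choose N + (N + 1) + (p + 1) * ((N : ℚ) - 5) := by
  -- For the initial coefficients it is simpler to keep the excess `N+1` factors `1/(1-x)`.
  have e : weightKernel (p + 1) j =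
      (𝔲 * 𝔳) ^ (p + 1) * (𝔳 ^ (N + 1) - PowerSeries.C 6 * (𝔵 * 𝔳 ^ (N + 1)) +
        𝔵 * (𝔵 * 𝔳 ^ (N + 1))) := by
    rw [weightKernel, ← h, mul_pow, pow_add 𝔳, map_ofNat]; ring
  set F := (𝔲 * 𝔳) ^ (p + 1) with hF
  have f0 : PowerSeries.coeff 0 F = 1 := by
    rw [hF, coeff_inv_mul_inv_pow_two_mul p 0, add_zero, Nat.choose_self, Nat.cast_one]
  have f1 : PowerSeries.coeff 1 F = 0 := coeff_inv_mul_inv_pow_odd (p + 1) 0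
  have f2 : PowerSeries.coeff 2 F = p + 1 := by
    have := coeff_inv_mul_inv_pow_two_mul p 1
    rw [Nat.choose_symm_add, Nat.choose_one_right] at this
    simpa using this
  have f3 : PowerSeries.coeff 3 F = 0 := coeff_inv_mul_inv_pow_odd (p + 1) 1
  set H := 𝔳 ^ (N + 1) - PowerSeries.C 6 * (𝔵 * 𝔳 ^ (N + 1)) + 𝔵 * (𝔵 * 𝔳 ^ (N + 1)) with hH
  have v0 := coeff_inv_one_sub_X_pow N 0
  have v1 := coeff_inv_one_sub_X_pow N 1
  have v2 := coeff_inv_one_sub_X_pow N 2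
  have v3 := coeff_inv_one_sub_X_pow N 3
  rw [Nat.choose_symm_add, Nat.choose_one_right] at v1
  simp only [add_zero, Nat.choose_self, Nat.cast_one] at v0
  push_cast at v1
  have x1 : PowerSeries.coeff 1 (𝔵 * 𝔳 ^ (N + 1)) = 1 := by
    rw [PowerSeries.coeff_succ_X_mul, v0]
  have x2 : PowerSeries.coeff 2 (𝔵 * 𝔳 ^ (N + 1)) = N + 1 := by
    rw [PowerSeries.coeff_succ_X_mul, v1]
  have x3 : PowerSeries.coeff 3 (𝔵 * 𝔳 ^ (N + 1)) = (N + 2).choose N := by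
    rw [PowerSeries.coeff_succ_X_mul, v2]
  have h0 : PowerSeries.coeff 0 H = 1 := by
    rw [hH]
    simp only [map_add, map_sub, PowerSeries.coeff_C_mul, PowerSeries.coeff_zero_X_mul, v0]
    ring
  have h1 : PowerSeries.coeff 1 H = (N : ℚ) - 5 := by
    rw [hH]
    simp only [map_add, map_sub, PowerSeries.coeff_C_mul, x1, v1]
    rw [PowerSeries.coeff_succ_X_mul, PowerSeries.coeff_zero_X_mul]
    ring
  have h2 : PowerSeries.coeff 2 H = ((N + 2).choose N : ℚ) - 6 * (N + 1) + 1 := by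
    rw [hH]
    simp only [map_add, map_sub, PowerSeries.coeff_C_mul, x2, v2]
    rw [PowerSeries.coeff_succ_X_mul, x1]
  have h3 : PowerSeries.coeff 3 H =
      ((N + 3).choose N : ℚ) - 6 * (N + 2).choose N + (N + 1) := by
    rw [hH]
    simp only [map_add, map_sub, PowerSeries.coeff_C_mul, x3, v3]
    rw [PowerSeries.coeff_succ_X_mul, x2]
  rw [e]
  simp only [PowerSeries.coeff_mul, Finset.Nat.sum_antidiagonal_eq_sum_range_succ_mk,
    Finset.sum_range_succ, Finset.sum_range_zero, Nat.succ_eq_add_one, Nat.reduceSub, Nat.reduceAdd,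
    Nat.sub_self, Nat.sub_zero, f0, f1, f2, f3, h0, h1, h2, h3]
  refine ⟨by ring, by ring, by ring, by ring⟩

/-- The recursion for the Gleason coefficients from the weight enumerator. -/
theorem IsNormalized.gleason_eq {m : ℕ} {c : ℕ → ℚ} (h : IsNormalized m c) (r p : ℕ)
    (hp : p + 1 + 4 * r = 4 * m + 6) :
    c (2 * m + r) = PowerSeries.coeff (2 * m + r) (weightKernel (p + 1) (2 * m + r)) +
      ∑ s ∈ Finset.range r, (gleasonPoly (12 * m + 5) (3 * m + 2) c).coeff (2 * m + 1 + s) *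
        PowerSeries.coeff (r - 1 - s) (weightKernel (p + 1) (2 * m + r)) := by
  obtain ⟨h0, h1, -⟩ := h
  rw [← coeff_gleasonPoly_mul_weightKernel (k := 12 * m + 5) (N := 3 * m + 2) (p := p + 1)
    (j := 2 * m + r) c (by omega) (by omega) (by omega),
    coeff_mul_of_gap _ _ (2 * m) r (by rw [Polynomial.coeff_coe, h0])
      (fun i h h' => by rw [Polynomial.coeff_coe, h1 i h h'])]
  simp only [Polynomial.coeff_coe]

/-- The Gleason coefficients from the shadow enumerator. -/
theorem IsNormalized.shadow_eq {m : ℕ} {c : ℕ → ℚ} (h : IsNormalized m c) (r : ℕ)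
    (hr : 1 ≤ r) (hrm : r ≤ m) :
    shadowScale (12 * m + 5) (2 * m + r) * c (2 * m + r) =
      (4 * m + 2 * r + (m + 1 - r)).choose (4 * m + 2 * r) +
        (4 * m + 2 * r + (m - r)).choose (4 * m + 2 * r) +
      if r = 1 then (gleasonPoly (12 * m + 5) (3 * m + 2) c).coeff (2 * m + 1) else 0 := by
  obtain ⟨-, -, h2, h3, h4⟩ := h
  rw [← coeff_shadowPoly_mul_kernel (k := 12 * m + 5) (J := 3 * m + 1) c (by omega)]
  have e2 : 2 * (2 * m + r) + 1 = (4 * m + 2 * r) + 1 := by ring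
  have e1 : 3 * m + 1 - (2 * m + r) = (m - r) + 1 := by omega
  have k0 : PowerSeries.coeff 0 ((1 + 𝔵) * 𝔳 ^ (4 * m + 2 * r + 1)) = 1 := by simp
  have k1 : PowerSeries.coeff (m - r + 1) ((1 + 𝔵) * 𝔳 ^ (4 * m + 2 * r + 1)) =
      ((4 * m + 2 * r + (m - r + 1)).choose (4 * m + 2 * r) : ℚ) +
        (4 * m + 2 * r + (m - r)).choose (4 * m + 2 * r) := by
    rw [add_mul, one_mul, map_add, PowerSeries.coeff_succ_X_mul, coeff_inv_one_sub_X_pow,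
      coeff_inv_one_sub_X_pow]
  rw [e1, e2]
  have e3 : m + 1 - r = m - r + 1 := by omega
  rw [e3, ← k1]
  -- The coefficient involved has index `m+1-r`. For `r = 1` it reaches `b_m = a_{2m+1}`; for `r ≥
  -- 2` only `b_0 = 1` contributes.
  split_ifs with hr1
  · subst hr1
    have := coeff_mul_of_gap (shadowPoly (12 * m + 5) (3 * m + 1) c)
      ((1 + 𝔵) * 𝔳 ^ (4 * m + 2 * 1 + 1)) (m - 1) 1 (by rw [Polynomial.coeff_coe, h2])
      (fun i h h' => by rw [Polynomial.coeff_coe, h3 i h h'])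
    rw [this, Finset.sum_range_one, Nat.sub_self, k0, mul_one, add_zero,
      Nat.sub_add_cancel hrm, h4, Polynomial.coeff_coe, mul_one]
  · have := coeff_mul_of_gap (shadowPoly (12 * m + 5) (3 * m + 1) c)
      ((1 + 𝔵) * 𝔳 ^ (4 * m + 2 * r + 1)) (m - r + 1) 0 (by rw [Polynomial.coeff_coe, h2])
      (fun i h h' => by rw [Polynomial.coeff_coe, h3 i h (by omega)])
    simpa using this

theorem shadowScale_eq (m r : ℕ) :
    shadowScale (12 * m + 5) (2 * m + r) = (-1) ^ r * (2 : ℚ) ^ ((5 : ℤ) - 6 * r) := by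
  rw [shadowScale, pow_add, Even.neg_one_pow ⟨m, by ring⟩, one_mul]
  congr 2
  push_cast; ring

theorem coeff_weightKernel_eq_sum (m r p M e D : ℕ) (hp : p + 4 * r = 4 * m + 6) (hr : 1 ≤ r)
    (hM : 2 * m + r = 2 * M + e) (he : e ≤ 1) (hD : 2 * D + e = 6 * r - 1 ∨ 2 * D + e = 6 * r - 2)
    (hDM : D ≤ M) :
    PowerSeries.coeff (2 * m + r) (weightKernel p (2 * m + r)) =
      ∑ t ∈ Finset.range D, (kernelPoly (6 * r - 5)).coeff (2 * t + e) *
        ((4 * m + 2 * r + (M - t)).choose (4 * m + 2 * r) : ℚ) := by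
  rw [weightKernel_eq_mul_kernelPoly p (6 * r - 5) _ (by omega),
    show 2 * (2 * m + r) + 1 = (4 * m + 2 * r) + 1 by ring, hM]
  -- `kernelPoly (6r-5)` has degree at most `6r-3`, so `D` terms of parity `e` suffice.
  exact coeff_inv_mul_inv_pow_mul _ M e D he _
    (fun s hs => kernelPoly_coeff_of_lt (by omega)) hDM

/-! ### Closed forms up to `a_{2m+4}` and its sign -/

theorem factorial_eq_mul_prod {n w : ℕ} (h : w ≤ n) :
    (n.factorial : ℚ) = (n - w).factorial * ∏ l ∈ Finset.range w, ((n : ℚ) - l) := by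
  induction w with
  | zero => simp
  | succ w ih =>
    rw [ih (by omega), Finset.prod_range_succ, show n - w = (n - (w + 1)) + 1 by omega,
      Nat.factorial_succ, show n - (w + 1) + 1 = n - w by omega, Nat.cast_mul,
      Nat.cast_sub (by omega)]
    ring

/-- The common factor of the binomial coefficients in the expansion. -/
noncomputable def baseQuotient (m : ℕ) : ℚ :=
  (5 * m).factorial / ((m + 2).factorial * (4 * m + 8).factorial)

/-- All factorials are compared with `(5m)!`, `(m+2)!` and `(4m+8)!`. The cofactor has `(u+2-w) + w
+ (8-u) = 10` linear factors, so every binomial coefficient becomes a polynomial of degree 10 in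
`m`. -/
theorem choose_eq_baseQuotient_mul (m u w : ℕ) (hu : u ≤ 8) (hw : w ≤ u + 2) (hm : w ≤ m + 2) :
    ((4 * m + u + (m + 2 - w)).choose (4 * m + u) : ℚ) = baseQuotient m *
      ((∏ l ∈ Finset.range (u + 2 - w), (5 * (m : ℚ) + (u + 2 - w : ℕ) - l)) *
      (∏ l ∈ Finset.range w, ((m : ℚ) + 2 - l)) *
      ∏ l ∈ Finset.range (8 - u), (4 * (m : ℚ) + 8 - l)) := by
  have h1 := factorial_eq_mul_prod (n := 4 * m + u + (m + 2 - w)) (w := u + 2 - w) (by omega)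
  have h2 := factorial_eq_mul_prod (n := m + 2) (w := w) hm
  have h3 := factorial_eq_mul_prod (n := 4 * m + 8) (w := 8 - u) (by omega)
  rw [show 4 * m + u + (m + 2 - w) - (u + 2 - w) = 5 * m by omega,
    show 4 * m + u + (m + 2 - w) = 5 * m + (u + 2 - w) by omega] at h1
  rw [show 4 * m + 8 - (8 - u) = 4 * m + u by omega] at h3
  rw [Nat.cast_add_choose, baseQuotient,
    show 4 * m + u + (m + 2 - w) = 5 * m + (u + 2 - w) by omega, h1, h2, h3]
  have hA : ((m + 2 - w).factorial : ℚ) ≠ 0 := by positivity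
  have hB : ((4 * m + u).factorial : ℚ) ≠ 0 := by positivity
  have hA' : ((m + 2).factorial : ℚ) ≠ 0 := by positivity
  have hB' : ((4 * m + 8).factorial : ℚ) ≠ 0 := by positivity
  rw [h2] at hA'
  rw [h3] at hB'
  have hA2 := right_ne_zero_of_mul hA'
  have hB2 := right_ne_zero_of_mul hB'
  push_cast at hA2 hB2 ⊢
  generalize ∏ l ∈ Finset.range w, ((m : ℚ) + 2 - l) = z at hA2 ⊢
  generalize ∏ l ∈ Finset.range (8 - u), (4 * (m : ℚ) + 8 - l) = z' at hB2 ⊢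
  generalize ∏ l ∈ Finset.range (u + 2 - w), (5 * (m : ℚ) + (u + 2 - w : ℕ) - l) = z''
  field_simp

/-- The quotient of the binomial coefficient `(4m + u + (m + 2 - w)).choose (4m + u)` by the common
factor. -/
noncomputable def chooseFactor (M : ℚ) (u w : ℕ) : ℚ :=
  (∏ l ∈ Finset.range (u + 2 - w), (5 * M + (u + 2 - w : ℕ) - l)) *
    (∏ l ∈ Finset.range w, (M + 2 - l)) * ∏ l ∈ Finset.range (8 - u), (4 * M + 8 - l)

theorem choose_eq_baseQuotient_mul_chooseFactor {m i : ℕ} (u w : ℕ) (hu : u ≤ 8) (hw : w ≤ u + 2)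
    (hi : i + w = m + 2) :
    ((4 * m + u + i).choose (4 * m + u) : ℚ) = baseQuotient m * chooseFactor m u w := by
  obtain rfl : i = m + 2 - w := by omega
  exact choose_eq_baseQuotient_mul m u w hu hw (by omega)

theorem coeff_weightKernel_eq_baseQuotient_mul {m : ℕ} (r p M e D w : ℕ)
    (hp : p + 4 * r = 4 * m + 6) (hr : 1 ≤ r) (hr' : r ≤ 4)
    (hM : 2 * m + r = 2 * M + e) (he : e ≤ 1) (hD : 2 * D + e = 6 * r - 1 ∨ 2 * D + e = 6 * r - 2)
    (hDM : D ≤ M) (hw : M + w = m + 2) (hDw : D + w ≤ 2 * r + 3) :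
    PowerSeries.coeff (2 * m + r) (weightKernel p (2 * m + r)) = baseQuotient m *
      ∑ t ∈ Finset.range D,
        (kernelPoly (6 * r - 5)).coeff (2 * t + e) * chooseFactor m (2 * r) (t + w) := by
  rw [coeff_weightKernel_eq_sum m r p M e D hp hr hM he hD hDM, Finset.mul_sum]
  refine Finset.sum_congr rfl fun t ht => ?_
  have := Finset.mem_range.mp ht
  rw [choose_eq_baseQuotient_mul_chooseFactor (2 * r) (t + w) (by omega) (by omega) (by omega)]
  ring

theorem IsNormalized.shadow_eq_baseQuotient_mul {m : ℕ} {c : ℕ → ℚ} (h : IsNormalized m c) (r : ℕ)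
    (hr : 1 ≤ r) (hr' : r ≤ 4) (hrm : r ≤ m) :
    (-1) ^ r * (2 : ℚ) ^ ((5 : ℤ) - 6 * r) * c (2 * m + r) =
      baseQuotient m * (chooseFactor m (2 * r) (r + 1) + chooseFactor m (2 * r) (r + 2)) +
      if r = 1 then (gleasonPoly (12 * m + 5) (3 * m + 2) c).coeff (2 * m + 1) else 0 := by
  rw [← shadowScale_eq, h.shadow_eq r hr hrm,
    choose_eq_baseQuotient_mul_chooseFactor (2 * r) (r + 1) (by omega) (by omega) (by omega),
    choose_eq_baseQuotient_mul_chooseFactor (2 * r) (r + 2) (by omega) (by omega) (by omega)]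
  ring

/-- This and the next seven lemmas expand, for `r = 1, …, 4`, the inhomogeneous terms of the two
expressions for `c_{2m+r}`. -/
theorem sum_kernelPoly_one (M : ℚ) :
    ∑ t ∈ Finset.range 2, (kernelPoly 1).coeff (2 * t + 1) * chooseFactor M 2 (t + 2) =
      (-491520) * M ^ 10 + (-5832704) * M ^ 9 + (-30269440) * M ^ 8 + (-90196992) * M ^ 7 +
      (-170280576) * M ^ 6 + (-211838016) * M ^ 5 + (-174820800) * M ^ 4 + (-93731008) * M ^
      3 + (-30885824) * M ^ 2 + (-5552640) * M + (-403200) := by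
  simp only [Finset.sum_range_succ, Finset.sum_range_zero, chooseFactor, Finset.prod_range_succ,
    Finset.prod_range_zero, Nat.reduceAdd, Nat.reduceMul, Nat.reduceSub,
    kernelPoly_coeff_one, kernelPoly_coeff_add_two]
  norm_num [Nat.choose]
  ring

theorem chooseFactor_shadow_one (M : ℚ) :
    chooseFactor M 2 2 + chooseFactor M 2 3 =
      122880 * M ^ 10 + 1447936 * M ^ 9 + 7450112 * M ^ 8 + 21967488 * M ^ 7 + 40933440 * M
      ^ 6 + 50093952 * M ^ 5 + 40485888 * M ^ 4 + 21132032 * M ^ 3 + 6727360 * M ^ 2 +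
      1158912 * M + 80640 := by
  simp only [chooseFactor, Finset.prod_range_succ, Finset.prod_range_zero, Nat.reduceAdd,
    Nat.reduceSub]
  norm_num
  ring

theorem sum_kernelPoly_two (M : ℚ) :
    ∑ t ∈ Finset.range 5, (kernelPoly 7).coeff (2 * t + 0) * chooseFactor M 4 (t + 1) =
      (-7864320) * M ^ 10 + (-85213184) * M ^ 9 + (-397471744) * M ^ 8 + (-1044888576) * M ^
      7 + (-1703202048) * M ^ 6 + (-1786308096) * M ^ 5 + (-1212960576) * M ^ 4 +
      (-524358784) * M ^ 3 + (-138078272) * M ^ 2 + (-20017920) * M + (-1209600) := by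
  simp only [Finset.sum_range_succ, Finset.sum_range_zero, chooseFactor, Finset.prod_range_succ,
    Finset.prod_range_zero, Nat.reduceAdd, Nat.reduceMul, Nat.reduceSub, kernelPoly_coeff_zero,
    kernelPoly_coeff_add_two]
  norm_num [Nat.choose]
  ring

theorem chooseFactor_shadow_two (M : ℚ) :
    chooseFactor M 4 3 + chooseFactor M 4 4 =
      38400 * M ^ 10 + 400640 * M ^ 9 + 1779232 * M ^ 8 + 4381968 * M ^ 7 + 6534768 * M ^ 6
      + 6048720 * M ^ 5 + 3427248 * M ^ 4 + 1130272 * M ^ 3 + 195392 * M ^ 2 + 13440 * M := by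
  simp only [chooseFactor, Finset.prod_range_succ, Finset.prod_range_zero, Nat.reduceAdd,
    Nat.reduceSub]
  norm_num
  ring

theorem sum_kernelPoly_three (M : ℚ) :
    ∑ t ∈ Finset.range 8, (kernelPoly 13).coeff (2 * t + 1) * chooseFactor M 6 (t + 1) =
      (-253231104) * M ^ 10 + (-2305949696) * M ^ 9 + (-8900853760) * M ^ 8 + (-19184566272)
      * M ^ 7 + (-25695489024) * M ^ 6 + (-22531206144) * M ^ 5 + (-13178461440) * M ^ 4 +
      (-5076245248) * M ^ 3 + (-1227602432) * M ^ 2 + (-167347200) * M + (-9676800) := by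
  simp only [Finset.sum_range_succ, Finset.sum_range_zero, chooseFactor, Finset.prod_range_succ,
    Finset.prod_range_zero, Nat.reduceAdd, Nat.reduceMul, Nat.reduceSub,
    kernelPoly_coeff_one, kernelPoly_coeff_add_two]
  norm_num [Nat.choose]
  ring

theorem chooseFactor_shadow_three (M : ℚ) :
    chooseFactor M 6 4 + chooseFactor M 6 5 =
      12000 * M ^ 10 + 87400 * M ^ 9 + 235880 * M ^ 8 + 259296 * M ^ 7 + 5424 * M ^ 6 +
      (-249336) * M ^ 5 + (-234840) * M ^ 4 + (-96016) * M ^ 3 + (-18464) * M ^ 2 + (-1344)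
      * M := by
  simp only [chooseFactor, Finset.prod_range_succ, Finset.prod_range_zero, Nat.reduceAdd,
    Nat.reduceSub]
  norm_num
  ring

theorem sum_kernelPoly_four (M : ℚ) :
    ∑ t ∈ Finset.range 11, (kernelPoly 19).coeff (2 * t + 0) * chooseFactor M 8 (t + 0) =
      (-8128561152) * M ^ 10 + (-54417686528) * M ^ 9 + (-161912848384) * M ^ 8 +
      (-288227377152) * M ^ 7 + (-338667122688) * M ^ 6 + (-271440356352) * M ^ 5 +
      (-148962594816) * M ^ 4 + (-54789100288) * M ^ 3 + (-12810394880) * M ^ 2 +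
      (-1703769600) * M + (-96768000) := by
  simp only [Finset.sum_range_succ, Finset.sum_range_zero, chooseFactor, Finset.prod_range_succ,
    Finset.prod_range_zero, Nat.reduceAdd, Nat.reduceMul, Nat.reduceSub, kernelPoly_coeff_zero,
    kernelPoly_coeff_add_two]
  norm_num [Nat.choose]
  ring

theorem chooseFactor_shadow_four (M : ℚ) :
    chooseFactor M 8 5 + chooseFactor M 8 6 =
      3750 * M ^ 10 + 8750 * M ^ 9 + (-11000) * M ^ 8 + (-40500) * M ^ 7 + (-23106) * M ^ 6
      + 18798 * M ^ 5 + 27780 * M ^ 4 + 12760 * M ^ 3 + 2576 * M ^ 2 + 192 * M := by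
  simp only [chooseFactor, Finset.prod_range_succ, Finset.prod_range_zero, Nat.reduceAdd,
    Nat.reduceSub]
  norm_num
  ring

/-- The coefficient `a_{2m+4}` of the weight enumerator, up to a positive factor. -/
noncomputable def fourthCoefficient (M : ℚ) : ℚ :=
  (-50790400) * M ^ 11 + 7845314560 * M ^ 10 + 39132110848 * M ^ 9 + 74203664384 * M ^ 8 +
  73721766144 * M ^ 7 + 43977018624 * M ^ 6 + 16845773248 * M ^ 5 + 4261126976 * M ^ 4 +
  707356736 * M ^ 3 + 73080256 * M ^ 2 + 4068864 * M + 80640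

/-- After the shift by 160, the negated polynomial has only positive terms. -/
theorem fourthCoefficient_neg {M : ℚ} (hM : 160 ≤ M) : fourthCoefficient M < 0 := by
  obtain ⟨q, hq, rfl⟩ : ∃ q : ℚ, 0 ≤ q ∧ M = q + 160 := ⟨M - 160, by linarith, by ring⟩
  rw [← neg_pos, fourthCoefficient]
  ring_nf
  positivity

/-- For each `r`, eliminating `c_{2m+r}` between `G_r` (from `W`) and `S_r` (from `S`) determines
`a_{2m+r}` from its predecessors. The bound 9 leaves room for the 11 binomial terms at `r = 4`. -/
theorem IsNormalized.coeff_two_mul_add_four {m : ℕ} {c : ℕ → ℚ} (h : IsNormalized m c)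
    (hm : 9 ≤ m) :
    (gleasonPoly (12 * m + 5) (3 * m + 2) c).coeff (2 * m + 4) =
      baseQuotient m * fourthCoefficient m := by
  have G1 := h.gleason_eq 1 (4 * m + 1) (by omega)
  have S1 := h.shadow_eq_baseQuotient_mul 1 (by omega) (by omega) (by omega)
  rw [coeff_weightKernel_eq_baseQuotient_mul 1 _ (m) 1 2 2 (by omega) (by omega)
    (by omega) (by omega) (by omega) (by omega) (by omega) (by omega) (by omega),
    sum_kernelPoly_one] at G1
  rw [chooseFactor_shadow_one] at S1
  obtain ⟨K0, K1, K2, K3⟩ := weightKernel_coeffs (4 * m + 1) 0 (2 * m + 1) (by omega)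
  norm_num [Finset.sum_range_succ, Nat.choose] at K0 K1 K2 K3 G1 S1
  simp only [K0] at G1
  clear K0 K1 K2 K3
  have G2 := h.gleason_eq 2 (4 * m - 3) (by omega)
  have S2 := h.shadow_eq_baseQuotient_mul 2 (by omega) (by omega) (by omega)
  rw [coeff_weightKernel_eq_baseQuotient_mul 2 _ (m + 1) 0 5 1 (by omega) (by omega)
    (by omega) (by omega) (by omega) (by omega) (by omega) (by omega) (by omega),
    sum_kernelPoly_two] at G2
  rw [chooseFactor_shadow_two] at S2
  obtain ⟨K0, K1, K2, K3⟩ := weightKernel_coeffs (4 * m - 3) 6 (2 * m + 2) (by omega)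
  rw [Nat.cast_sub (by omega)] at K2 K3
  norm_num [Finset.sum_range_succ, Nat.choose] at K0 K1 K2 K3 G2 S2
  simp only [K0, K1] at G2
  clear K0 K1 K2 K3
  have G3 := h.gleason_eq 3 (4 * m - 7) (by omega)
  have S3 := h.shadow_eq_baseQuotient_mul 3 (by omega) (by omega) (by omega)
  rw [coeff_weightKernel_eq_baseQuotient_mul 3 _ (m + 1) 1 8 1 (by omega) (by omega)
    (by omega) (by omega) (by omega) (by omega) (by omega) (by omega) (by omega),
    sum_kernelPoly_three] at G3
  rw [chooseFactor_shadow_three] at S3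
  obtain ⟨K0, K1, K2, K3⟩ := weightKernel_coeffs (4 * m - 7) 12 (2 * m + 3) (by omega)
  rw [Nat.cast_sub (by omega)] at K2 K3
  norm_num [Finset.sum_range_succ, Nat.choose] at K0 K1 K2 K3 G3 S3
  simp only [K0, K1, K2] at G3
  clear K0 K1 K2 K3
  have G4 := h.gleason_eq 4 (4 * m - 11) (by omega)
  have S4 := h.shadow_eq_baseQuotient_mul 4 (by omega) (by omega) (by omega)
  rw [coeff_weightKernel_eq_baseQuotient_mul 4 _ (m + 2) 0 11 0 (by omega) (by omega)
    (by omega) (by omega) (by omega) (by omega) (by omega) (by omega) (by omega),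
    sum_kernelPoly_four] at G4
  rw [chooseFactor_shadow_four] at S4
  obtain ⟨K0, K1, K2, K3⟩ := weightKernel_coeffs (4 * m - 11) 18 (2 * m + 4) (by omega)
  rw [Nat.cast_sub (by omega)] at K2 K3
  norm_num [Finset.sum_range_succ, Nat.choose] at K0 K1 K2 K3 G4 S4
  simp only [K0, K1, K2, K3] at G4
  clear K0 K1 K2 K3
  simp only [show 2 * m + 1 + 1 = 2 * m + 2 from rfl, show 2 * m + 1 + 2 = 2 * m + 3 from rfl,
    show 2 * m + 1 + 3 = 2 * m + 4 from rfl] at G2 G3 G4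
  rw [fourthCoefficient]
  generalize (gleasonPoly (12 * m + 5) (3 * m + 2) c).coeff (2 * m + 1) = a₁ at *
  generalize (gleasonPoly (12 * m + 5) (3 * m + 2) c).coeff (2 * m + 2) = a₂ at *
  generalize (gleasonPoly (12 * m + 5) (3 * m + 2) c).coeff (2 * m + 3) = a₃ at *
  generalize (gleasonPoly (12 * m + 5) (3 * m + 2) c).coeff (2 * m + 4) = a₄ at *
  generalize baseQuotient m = T at *
  -- At `r = 1` the unknown occurs in both equations: `c = Tw + a₁` and `-c/2 = Ts + a₁`, hence the
  -- denominators 3.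
  have A1 : a₁ = T * (
      81920 * (m : ℚ) ^ 10 + 978944 * (m : ℚ) ^ 9 + 5123072 * (m : ℚ) ^ 8 + 15420672 * (m :
      ℚ) ^ 7 + 29471232 * (m : ℚ) ^ 6 + 37216704 * (m : ℚ) ^ 5 + 31283008 * (m : ℚ) ^ 4 +
      17155648 * (m : ℚ) ^ 3 + 5810368 * (m : ℚ) ^ 2 + 1078272 * (m : ℚ) + 80640) := by
    linear_combination (-2 / 3) * S1 - (1 / 3) * G1
  -- From here on `S_r` has no unknown but `c_{2m+r}`; the multipliers `128`, `-8192`, `524288` are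
  -- the inverses of `(-1)^r 2^(5-6r)`, and the other factors are initial kernel coefficients.
  have A2 : a₂ = T * (
      12697600 * (m : ℚ) ^ 10 + 135516160 * (m : ℚ) ^ 9 + 620090368 * (m : ℚ) ^ 8 +
      1590359808 * (m : ℚ) ^ 7 + 2510181120 * (m : ℚ) ^ 6 + 2523327552 * (m : ℚ) ^ 5 +
      1620365312 * (m : ℚ) ^ 4 + 651877952 * (m : ℚ) ^ 3 + 157278080 * (m : ℚ) ^ 2 +
      20659968 * (m : ℚ) + 1128960) := by
    linear_combination 128 * S2 - G2 - A1
  have A3 : a₃ = T * (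
      (-327680) * (m : ℚ) ^ 11 + 61472768 * (m : ℚ) ^ 10 + 613031936 * (m : ℚ) ^ 9 +
      2525224960 * (m : ℚ) ^ 8 + 5686644480 * (m : ℚ) ^ 7 + 7695151104 * (m : ℚ) ^ 6 +
      6487608128 * (m : ℚ) ^ 5 + 3440826880 * (m : ℚ) ^ 4 + 1139176000 * (m : ℚ) ^ 3 +
      227116928 * (m : ℚ) ^ 2 + 24788736 * (m : ℚ) + 1128960) := by
    linear_combination -8192 * S3 - G3 - (14 + (4 * (m : ℚ) - 7 + 1)) * A1 - 7 * A2
  linear_combination 524288 * S4 - G4 - (209 + (4 * (m : ℚ) - 11 + 1) * 13) * A1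
    - (77 + (4 * (m : ℚ) - 11 + 1)) * A2 - 13 * A3

theorem baseQuotient_pos (m : ℕ) : 0 < baseQuotient m := by
  unfold baseQuotient; positivity

/-- For `m ≥ 160` the coefficient `a_{2m+4}` is negative. -/
theorem IsNormalized.exists_coeff_neg {m : ℕ} {c : ℕ → ℚ} (h : IsNormalized m c)
    (hm : 160 ≤ m) :
    (gleasonPoly (12 * m + 5) (3 * m + 2) c).coeff (2 * m + 4) < 0 := by
  rw [h.coeff_two_mul_add_four (by omega)]
  exact mul_neg_of_pos_of_neg (baseQuotient_pos m)
    (fourthCoefficient_neg (by exact_mod_cast hm))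

/-! ### Reading coefficients from the value at a large integer -/

/-- The homogeneous form `∑ lᵢ F^(n-1-i) G^i` with coefficient list `l` of length `n`. -/
def homForm {R : Type*} [Semiring R] (F G : R) : List R → R
  | [] => 0
  | a :: l => a * F ^ l.length + G * homForm F G l

/-- Splitting the list allows balanced evaluation, with few multiplications of very large numbers.
-/
theorem homForm_append {R : Type*} [CommSemiring R] (F G : R) (l l' : List R) :
    homForm F G (l ++ l') = homForm F G l * F ^ l'.length + G ^ l.length * homForm F G l' := by
  induction l with
  | nil => simp [homForm]
  | cons a l ih =>
    simp only [List.cons_append, homForm, ih, List.length_append, List.length_cons]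
    ring

theorem map_homForm {R S : Type*} [Semiring R] [Semiring S] (φ : R →+* S) (F G : R) (l : List R) :
    φ (homForm F G l) = homForm (φ F) (φ G) (l.map φ) := by
  induction l with
  | nil => simp [homForm]
  | cons a l ih => simp [homForm, ih]

theorem homForm_eq_sum {R : Type*} [CommSemiring R] (F G : R) (l : List R) :
    homForm F G l =
      ∑ j ∈ Finset.range l.length, l.getD j 0 * F ^ (l.length - 1 - j) * G ^ j := by
  induction l with
  | nil => simp [homForm]
  | cons a l ih =>
    rw [homForm, ih, List.length_cons, Finset.sum_range_succ', Finset.mul_sum, add_comm]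
    congr 1
    · refine Finset.sum_congr rfl fun j hj => ?_
      rw [List.getD_cons_succ, show l.length + 1 - 1 - (j + 1) = l.length - 1 - j by omega]
      ring
    · simp

/-- Evaluation of `homForm` at natural numbers. -/
def evalBlock (F G : ℕ) : List ℤ → ℤ
  | [] => 0
  | a :: l => a * (F ^ l.length : ℕ) + (G : ℤ) * evalBlock F G l

theorem evalBlock_eq (F G : ℕ) (l : List ℤ) : evalBlock F G l = homForm (F : ℤ) (G : ℤ) l := by
  induction l with
  | nil => rw [evalBlock, homForm]
  | cons a l ih => rw [evalBlock, homForm, ih]; push_cast; rfl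

/-- Evaluation of `homForm` at natural numbers, with repeated halving of the coefficient list. -/
def evalForm (F G : ℕ) : ℕ → List ℤ → ℤ
  | 0, l => evalBlock F G l
  | d + 1, l => evalForm F G d (l.take (8 * 2 ^ d)) * (F ^ (l.drop (8 * 2 ^ d)).length : ℕ)
      + (G ^ (8 * 2 ^ d) : ℕ) * evalForm F G d (l.drop (8 * 2 ^ d))

theorem evalForm_eq (F G d : ℕ) (l : List ℤ) :
    evalForm F G d l = homForm (F : ℤ) (G : ℤ) l := by
  induction d generalizing l with
  | zero => rw [evalForm, evalBlock_eq]
  | succ d ih =>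
    rw [evalForm, ih, ih]
    conv_rhs => rw [← List.take_append_drop (8 * 2 ^ d) l, homForm_append]
    by_cases hl : l.length ≤ 8 * 2 ^ d
    · rw [List.drop_eq_nil_of_le hl]
      simp [homForm]
    · rw [List.length_take, min_eq_left (by omega)]
      push_cast
      rfl

/-- The value `∑ |lᵢ| 4^(n-1-i)` for a list of length `n`, added to `a 4^n`. -/
def absFormDown : ℕ → List ℤ → ℕ
  | a, [] => a
  | a, b :: l => absFormDown (4 * a + b.natAbs) l

/-- The value `∑ |lᵢ| 4^i`. -/
def absFormUp : List ℤ → ℕ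
  | [] => 0
  | b :: l => b.natAbs + 4 * absFormUp l

/-- In `16^(n-1-i) 4^i` the factor `4^(n-1)` is common to all terms; taking it out keeps the
accumulated sum in powers of 4. -/
theorem absFormDown_eq (a : ℕ) (l : List ℤ) :
    4 ^ l.length * (absFormDown a l : ℤ) = 16 ^ l.length * a + 4 * homForm 16 4 (l.map abs) := by
  induction l generalizing a with
  | nil => simp [absFormDown, homForm]
  | cons b l ih =>
    have := ih (4 * a + b.natAbs)
    rw [absFormDown, List.map_cons, homForm, List.length_cons, List.length_map, Int.abs_eq_natAbs,
      pow_succ, pow_succ]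
    push_cast at this ⊢
    linear_combination 4 * this

theorem absFormUp_eq (l : List ℤ) : (absFormUp l : ℤ) = homForm 1 4 (l.map abs) := by
  induction l with
  | nil => simp [absFormUp, homForm]
  | cons b l ih =>
    rw [absFormUp, List.map_cons, homForm, ← ih, Int.abs_eq_natAbs]
    push_cast; ring

/-- `Q` dominates `P` coefficientwise. -/
def Dominates (Q P : ℤ[X]) : Prop := ∀ i, |P.coeff i| ≤ Q.coeff i

theorem Dominates.add {P P' Q Q' : ℤ[X]} (h : Dominates Q P) (h' : Dominates Q' P') :
    Dominates (Q + Q') (P + P') := fun i => by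
  rw [coeff_add, coeff_add]
  exact (abs_add_le _ _).trans (add_le_add (h i) (h' i))

theorem Dominates.mul {P P' Q Q' : ℤ[X]} (h : Dominates Q P) (h' : Dominates Q' P') :
    Dominates (Q * Q') (P * P') := fun i => by
  rw [coeff_mul, coeff_mul]
  refine (Finset.abs_sum_le_sum_abs _ _).trans (Finset.sum_le_sum fun x _ => ?_)
  rw [abs_mul]
  exact mul_le_mul (h _) (h' _) (abs_nonneg _) ((abs_nonneg _).trans (h _))

theorem dominates_one : Dominates 1 1 := fun i => by
  rw [coeff_one]; split_ifs <;> simp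

theorem dominates_X : Dominates X X := fun i => by
  rw [coeff_X]; split_ifs <;> simp

theorem dominates_C (a : ℤ) : Dominates (C |a|) (C a) := fun i => by
  rw [coeff_C, coeff_C]; split_ifs <;> simp

theorem Dominates.neg {P Q : ℤ[X]} (h : Dominates Q P) : Dominates Q (-P) := fun i => by
  rw [coeff_neg, abs_neg]; exact h i

theorem Dominates.pow {P Q : ℤ[X]} (h : Dominates Q P) (n : ℕ) : Dominates (Q ^ n) (P ^ n) := by
  induction n with
  | zero => simpa using dominates_one
  | succ n ih => rw [pow_succ, pow_succ]; exact ih.mul h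

theorem dominates_one_sub_X : Dominates (1 + X) (1 - X) := by
  rw [sub_eq_add_neg]; exact dominates_one.add dominates_X.neg

theorem Dominates.homForm {F F' G G' : ℤ[X]} (hF : Dominates F' F) (hG : Dominates G' G)
    (l : List ℤ) :
    Dominates (homForm F' G' ((l.map abs).map C)) (homForm F G (l.map C)) := by
  induction l with
  | nil => intro i; simp [BinaryCode.homForm]
  | cons a l ih =>
    simp only [List.map_cons, BinaryCode.homForm, List.length_map]
    exact ((dominates_C a).mul (hF.pow _)).add (hG.mul ih)

/-- The coefficients of `Q` are nonnegative, and the value at 1 is their sum. -/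
theorem Dominates.abs_coeff_le_eval {P Q : ℤ[X]} (h : Dominates Q P) (i : ℕ) :
    |P.coeff i| ≤ Q.eval 1 := by
  have h0 : ∀ j, 0 ≤ Q.coeff j := fun j => (abs_nonneg _).trans (h j)
  refine (h i).trans ?_
  rw [eval_eq_sum_range]
  simp only [one_pow, mul_one]
  by_cases hi : i ≤ Q.natDegree
  · exact Finset.single_le_sum (f := fun j => Q.coeff j) (fun j _ => h0 j)
      (Finset.mem_range.mpr (Nat.lt_succ_iff.mpr hi))
  · rw [coeff_eq_zero_of_natDegree_lt (by omega)]
    exact Finset.sum_nonneg fun j _ => h0 j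

theorem mod_pow_div_pow_mod {B : ℕ} (N : ℕ) {i h : ℕ} (hi : i < h) :
    N % B ^ h / B ^ i % B = N / B ^ i % B := by
  obtain ⟨t, rfl⟩ : ∃ t, h = i + (t + 1) := ⟨h - i - 1, by omega⟩
  rw [pow_add, Nat.mod_mul_right_div_self, pow_succ', Nat.mod_mul_right_mod]

/-- Bound on digits from a bit mask. -/
theorem digit_lt_of_land_eq_zero (K L : ℕ) {N : ℕ}
    (h : N &&& (2 ^ K * ∑ i ∈ Finset.range L, (2 ^ (K + 1)) ^ i) = 0) :
    ∀ i < L, N / (2 ^ (K + 1)) ^ i % 2 ^ (K + 1) < 2 ^ K := by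
  induction L generalizing N with
  | zero => intro i hi; omega
  | succ L ih =>
    have e : 2 ^ K * ∑ i ∈ Finset.range (L + 1), (2 ^ (K + 1)) ^ i =
        2 ^ (K + 1) * (2 ^ K * ∑ i ∈ Finset.range L, (2 ^ (K + 1)) ^ i) + 2 ^ K := by
      rw [Finset.sum_range_succ', pow_zero, mul_add, mul_one]
      simp only [pow_succ (2 ^ (K + 1))]
      rw [← Finset.sum_mul]; ring
    have hK : 2 ^ K < 2 ^ (K + 1) := Nat.pow_lt_pow_right (by norm_num) (by omega)
    have h1 := congrArg (· % 2 ^ (K + 1)) h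
    have h2 := congrArg (· / 2 ^ (K + 1)) h
    simp only [Nat.zero_mod, Nat.zero_div, Nat.and_mod_two_pow, Nat.and_div_two_pow] at h1 h2
    rw [e] at h1 h2
    rw [Nat.mul_add_mod, Nat.mod_eq_of_lt hK, Nat.and_two_pow] at h1
    rw [Nat.mul_add_div (by positivity), Nat.div_eq_of_lt hK, add_zero] at h2
    intro i hi
    match i with
    | 0 =>
      rw [pow_zero, Nat.div_one]
      have h3 : (N % 2 ^ (K + 1)).testBit K = false := by
        by_contra hne
        rw [Bool.not_eq_false] at hne
        rw [hne] at h1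
        simp at h1
      have h4 := Nat.mod_lt N (show 0 < 2 ^ (K + 1) by positivity)
      by_contra hge
      rw [Nat.testBit_eq_decide_div_mod_eq, decide_eq_false_iff_not] at h3
      have h5 : N % 2 ^ (K + 1) / 2 ^ K = 1 := by
        rw [Nat.div_eq_iff (by positivity)]
        have h6 : 2 ^ (K + 1) = 2 ^ K * 2 := pow_succ 2 K
        omega
      exact h3 (by rw [h5])
    | i + 1 =>
      rw [pow_succ', ← Nat.div_div_eq_div_mul]
      exact ih h2 i (by omega)

/-- Whether `N` has at most `L` digits in base `2^(K+1)`, each of them less than `2^K`. -/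
def digitsSmall (K L N : ℕ) : Bool :=
  Nat.beq (N &&& (2 ^ K * (((2 ^ (K + 1)) ^ L - 1) / (2 ^ (K + 1) - 1)))) 0 &&
    Nat.ble (N + 1) ((2 ^ (K + 1)) ^ L)

theorem two_mul_digit_lt {K L N : ℕ} (h : digitsSmall K L N = true) (i : ℕ) :
    2 * (N / (2 ^ (K + 1)) ^ i % 2 ^ (K + 1)) < 2 ^ (K + 1) := by
  have hK : 2 ^ (K + 1) = 2 ^ K * 2 := pow_succ 2 K
  have hK' : 0 < 2 ^ K := by positivity
  rw [digitsSmall, Bool.and_eq_true] at h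
  have h2 : N < (2 ^ (K + 1)) ^ L := Nat.le_of_ble_eq_true h.2
  rcases lt_or_ge i L with hi | hi
  · have h1 := Nat.eq_of_beq_eq_true h.1
    -- The quotient in `digitsSmall` is a geometric sum, so the mask has exactly the top bit of each
    -- of the `L` digits.
    rw [← Nat.geomSum_eq (by omega)] at h1
    have := digit_lt_of_land_eq_zero K L h1 i hi
    omega
  · rw [Nat.div_eq_of_lt (h2.trans_le (Nat.pow_le_pow_right (by omega) hi)), Nat.zero_mod]
    omega

/-- A polynomial with small coefficients is determined by its value at a large number. -/
theorem coeff_eq_digit {B : ℕ} (i : ℕ) : ∀ {P : ℤ[X]} {N : ℕ},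
    (∀ j, 2 * |P.coeff j| < B) → P.eval (B : ℤ) = N → (∀ j, 2 * (N / B ^ j % B) < B) →
    P.coeff i = ((N / B ^ i % B : ℕ) : ℤ) := by
  have step : ∀ {P : ℤ[X]} {N : ℕ}, (∀ j, 2 * |P.coeff j| < B) → P.eval (B : ℤ) = N →
      (∀ j, 2 * (N / B ^ j % B) < B) → P.coeff 0 = ((N % B : ℕ) : ℤ) := by
    intro P N hP hN hd
    have h0 := hP 0
    have h1 := hd 0
    rw [pow_zero, Nat.div_one] at h1
    -- The constant term and the last digit agree modulo `B`, and both are less than `B/2` in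
    -- absolute value.
    have h2 : (B : ℤ) ∣ P.coeff 0 - ((N % B : ℕ) : ℤ) := by
      have e : P.eval (B : ℤ) = P.divX.eval (B : ℤ) * B + P.coeff 0 := by
        conv_lhs => rw [← divX_mul_X_add P]
        simp
      refine ⟨(N / B : ℕ) - P.divX.eval (B : ℤ), ?_⟩
      have e2 : (N : ℤ) = B * (N / B : ℕ) + (N % B : ℕ) := by
        exact_mod_cast (Nat.div_add_mod N B).symm
      linear_combination e2 - hN.symm.trans e
    refine sub_eq_zero.mp (Int.eq_zero_of_abs_lt_dvd h2 ?_)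
    have h3 : (2 : ℤ) * ((N % B : ℕ) : ℤ) < B := by exact_mod_cast h1
    have h4 : (0 : ℤ) ≤ ((N % B : ℕ) : ℤ) := Int.natCast_nonneg _
    have h5 := abs_lt.mp (show |P.coeff 0| < |P.coeff 0| + 1 by omega)
    rw [abs_lt]
    constructor <;> omega
  induction i with
  | zero => intro P N hP hN hd; rw [pow_zero, Nat.div_one]; exact step hP hN hd
  | succ i ih =>
    intro P N hP hN hd
    have hB : 0 < B := by have := hd 0; omega
    have h0 := step hP hN hd
    have e : P.eval (B : ℤ) = P.divX.eval (B : ℤ) * B + P.coeff 0 := by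
      conv_lhs => rw [← divX_mul_X_add P]
      simp
    have e2 : (N : ℤ) = B * (N / B : ℕ) + (N % B : ℕ) := by
      exact_mod_cast (Nat.div_add_mod N B).symm
    -- Removing the constant term and dividing by `B` matches deleting the last digit of `N`.
    have e3 : P.divX.eval (B : ℤ) = ((N / B : ℕ) : ℤ) := by
      have hB' : (B : ℤ) ≠ 0 := by exact_mod_cast hB.ne'
      apply mul_right_cancel₀ hB'
      rw [hN, h0] at e
      linear_combination e2 - e
    have := ih (P := P.divX) (N := N / B) (fun j => by rw [coeff_divX]; exact hP _) e3
      (fun j => by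
        have := hd (j + 1)
        rwa [pow_succ', ← Nat.div_div_eq_div_mul] at this)
    rw [coeff_divX] at this
    rw [this, pow_succ', ← Nat.div_div_eq_div_mul]

/-! ### The numerical certificate for `m ≤ 159` -/

/-- The lists `c` and `d` are proportional, with the ratio `s / t` multiplied by `-1 / 64` at each
step. -/
def ScaledLists (s t : ℤ) (c d : List ℤ) : Prop :=
  c.length = d.length ∧ ∀ j, c.getD j 0 * ((-1) ^ j * s) = d.getD j 0 * (64 ^ j * t)

theorem ScaledLists.cons {s t a b : ℤ} {c d : List ℤ} (hab : a * s = b * t)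
    (h : ScaledLists (-s) (64 * t) c d) : ScaledLists s t (a :: c) (b :: d) := by
  refine ⟨by simp [h.1], fun j => ?_⟩
  match j with
  | 0 => simpa using hab
  | j + 1 =>
    have := h.2 j
    simp only [List.getD_cons_succ]
    rw [pow_succ, pow_succ]
    linear_combination this

/-- Multiply the entries by `2^e, -2^(e-6), 2^(e-12), …`, or by the negatives of these. -/
def scaleDown : Bool → ℕ → List ℤ → List ℤ
  | _, _, [] => []
  | false, e, a :: l => a * (2 ^ e : ℕ) :: scaleDown true (e - 6) l
  | true, e, a :: l => -(a * (2 ^ e : ℕ)) :: scaleDown false (e - 6) l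

/-- Multiply the entries by `2^e, -2^(e+6), 2^(e+12), …`, or by the negatives of these. -/
def scaleUp : Bool → ℕ → List ℕ → List ℤ
  | _, _, [] => []
  | false, e, a :: l => ((a * 2 ^ e : ℕ) : ℤ) :: scaleUp true (e + 6) l
  | true, e, a :: l => -((a * 2 ^ e : ℕ) : ℤ) :: scaleUp false (e + 6) l

theorem scaledLists_scaleUp {s t : ℤ} {e : ℕ} (h : 2 ^ e * s = t) (l : List ℕ) :
    ScaledLists s t (scaleUp false e l) (l.map fun a : ℕ => (a : ℤ)) ∧
      ScaledLists (-s) t (scaleUp true e l) (l.map fun a : ℕ => (a : ℤ)) := by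
  induction l generalizing e t with
  | nil => simp [ScaledLists, scaleUp]
  | cons a l ih =>
    obtain ⟨h1, h2⟩ := ih (e := e + 6) (t := 64 * t) (by rw [← h, pow_add]; ring)
    simp only [scaleUp]
    push_cast
    exact ⟨.cons (by rw [← h]; ring) h2, .cons (by rw [← h]; ring) (by rwa [neg_neg])⟩

theorem ScaledLists.scaleDown_append {s t : ℤ} {e : ℕ} (h : 2 ^ e * t = s) {l c d : List ℤ}
    (hl : 6 * l.length ≤ e + 6)
    (hcd : ScaledLists ((-1) ^ l.length * s) (64 ^ l.length * t) c d) :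
    ScaledLists s t (l ++ c) (scaleDown false e l ++ d) := by
  -- Signs alternate along the list, so both starting signs are treated in one induction.
  suffices H : ∀ (l : List ℤ) (e : ℕ) (t : ℤ), 2 ^ e * t = s → 6 * l.length ≤ e + 6 →
      (ScaledLists ((-1) ^ l.length * s) (64 ^ l.length * t) c d →
        ScaledLists s t (l ++ c) (scaleDown false e l ++ d)) ∧
      (ScaledLists ((-1) ^ l.length * (-s)) (64 ^ l.length * t) c d →
        ScaledLists (-s) t (l ++ c) (scaleDown true e l ++ d)) from (H l e t h hl).1 hcd
  intro l
  induction l with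
  | nil => intro e t _ _; simp [scaleDown]
  | cons a l ih =>
    intro e t h hl
    rw [List.length_cons] at hl
    simp only [scaleDown, List.cons_append, List.length_cons]
    push_cast
    have h64 : ∀ x : ℤ, 64 ^ (l.length + 1) * x = 64 ^ l.length * (64 * x) := fun x => by ring
    have hneg : ∀ x : ℤ, (-1) ^ (l.length + 1) * x = (-1) ^ l.length * -x := fun x => by ring
    rw [h64, hneg, hneg]
    -- The exponent may be below 6 at the last entry; `e - 6` is a true difference whenever the tail
    -- is nonempty.
    by_cases hl0 : l = []
    · subst hl0
      simp only [scaleDown, List.nil_append, List.length_nil, pow_zero, one_mul]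
      exact ⟨fun h' => .cons (by rw [← h]; ring) h', fun h' => .cons (by rw [← h]; ring) h'⟩
    · have hl1 : 1 ≤ l.length := List.length_pos_of_ne_nil hl0
      obtain ⟨f, rfl⟩ : ∃ f, e = f + 6 := ⟨e - 6, by omega⟩
      obtain ⟨h1, h2⟩ := ih f (64 * t) (by rw [← h, pow_add]; ring) (by omega)
      rw [Nat.add_sub_cancel]
      exact ⟨fun h' => .cons (by rw [← h]; ring) (h2 h'),
        fun h' => .cons (by rw [← h]; ring) (by rw [neg_neg] at h' ⊢; exact h1 h')⟩

/-- Numerical certificate that the integer lists `c` and `d` are the coefficients of an enumerator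
pair with nonnegative integer coefficients: `N` and `N'` are the values of the two polynomials at the
large number `2^(K+1)`, whose digits are the coefficients. -/
def checkLists (m K : ℕ) (c d : List ℤ) (N N' : ℤ) : Bool :=
  Nat.ble (4 ^ (3 * m + 2) * absFormDown 0 c + 1) (2 ^ (K + 1)) &&
  (Nat.ble (2 * absFormUp d + 1) (2 ^ (K + 1)) &&
  (decide (0 ≤ N) && (decide (0 ≤ N') &&
  (digitsSmall K (12 * m + 6) N.toNat && (digitsSmall K (6 * m + 3) N'.toNat &&
  (Nat.beq (N.toNat % (2 ^ (K + 1)) ^ (2 * m + 1)) 1 &&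
  (Nat.beq (N'.toNat % (2 ^ (K + 1)) ^ m) 1 &&
  Nat.beq (N.toNat / (2 ^ (K + 1)) ^ (2 * m + 1) % 2 ^ (K + 1))
    (N'.toNat / (2 ^ (K + 1)) ^ m % 2 ^ (K + 1)))))))))

theorem gleasonPoly_eq_map (m : ℕ) (c : List ℤ) (hc : c.length = 3 * m + 2) :
    gleasonPoly (12 * m + 5) (3 * m + 2) (fun j => (c.getD j 0 : ℚ)) =
      ((1 + X) * homForm ((1 + X) ^ 4) (X * (1 - X) ^ 2) (c.map C)).map (Int.castRingHom ℚ) := by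
  rw [homForm_eq_sum, List.length_map, hc, Finset.mul_sum, Polynomial.map_sum, gleasonPoly]
  refine Finset.sum_congr rfl fun j hj => ?_
  have hj' := Finset.mem_range.mp hj
  have e : (c.map C).getD j (0 : ℤ[X]) = C (c.getD j 0) := by
    rw [← C_0, List.getD_map]
  -- The exponent is `1` modulo 4, whence the separate factor `1 + X` in front of a form in
  -- `(1+X)⁴`.
  have e2 : 12 * m + 5 - 4 * j = 4 * (3 * m + 2 - 1 - j) + 1 := by omega
  rw [e, gleasonTerm, e2]
  simp only [Polynomial.map_mul, Polynomial.map_pow, Polynomial.map_add, Polynomial.map_sub,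
    Polynomial.map_one, Polynomial.map_X, Polynomial.map_C, Int.coe_castRingHom]
  rw [pow_succ, pow_mul]
  ring

theorem shadowPoly_eq_map (m : ℕ) (c : ℕ → ℚ) (d : List ℤ) (hd : d.length = 3 * m + 2)
    (h : ∀ j, shadowScale (12 * m + 5) j * c j = (d.getD j 0 : ℚ)) :
    shadowPoly (12 * m + 5) (3 * m + 1) c =
      (homForm X ((1 - X) ^ 2) (d.map C)).map (Int.castRingHom ℚ) := by
  rw [homForm_eq_sum, List.length_map, hd, Polynomial.map_sum, shadowPoly]
  refine Finset.sum_congr rfl fun j hj => ?_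
  have e : (d.map C).getD j (0 : ℤ[X]) = C (d.getD j 0) := by
    rw [← C_0, List.getD_map]
  rw [e, shadowTerm, h j, show 3 * m + 2 - 1 - j = 3 * m + 1 - j by omega]
  simp only [Polynomial.map_mul, Polynomial.map_pow, Polynomial.map_sub,
    Polynomial.map_one, Polynomial.map_X, Polynomial.map_C, Int.coe_castRingHom]
  ring

theorem ScaledLists.shadowScale_mul_eq {k : ℕ} {c d : List ℤ} (h : ScaledLists (2 ^ k) 1 c d)
    (j : ℕ) : shadowScale k j * (c.getD j 0 : ℚ) = (d.getD j 0 : ℚ) := by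
  have h1 := congrArg (Int.cast (R := ℚ)) (h.2 j)
  push_cast at h1
  have h64 : ((64 : ℚ) ^ j) ≠ 0 := by positivity
  rw [shadowScale, zpow_sub₀ (by norm_num), zpow_natCast, zpow_mul,
    show ((2 : ℚ) ^ (6 : ℤ)) = 64 by norm_num, zpow_natCast]
  field_simp
  linear_combination h1

/-- A single congruence thus encodes a leading coefficient 1 followed by a run of zeros. -/
theorem coeff_eq_of_mod_eq_one {B h N : ℕ} {P : ℤ[X]} (hB : 1 < B)
    (hP : ∀ i, P.coeff i = ((N / B ^ i % B : ℕ) : ℤ)) (h1 : N % B ^ h = 1) {i : ℕ} (hi : i < h) :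
    P.coeff i = if i = 0 then 1 else 0 := by
  rw [hP, ← mod_pow_div_pow_mod N hi, h1]
  split_ifs with h0
  · rw [h0, pow_zero, Nat.div_one, Nat.mod_eq_of_lt hB, Nat.cast_one]
  · rw [Nat.div_eq_of_lt (Nat.one_lt_pow h0 hB), Nat.zero_mod, Nat.cast_zero]

/-- The first two checks bound all coefficients by `B/2`, where `B = 2^(K+1)`; the digit checks make
every digit less than `B/2`. So the digits of the two values are the coefficients, which are then
natural numbers, and the remaining checks are the normalization conditions on digits. -/
theorem exists_isNormalized_of_checkLists {m K D : ℕ} {c d : List ℤ} (hm : 1 ≤ m)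
    (hs : ScaledLists (2 ^ (12 * m + 5)) 1 c d) (hc : c.length = 3 * m + 2)
    (h : checkLists m K c d
      ((1 + 2 ^ (K + 1) : ℕ) *
        evalForm ((1 + 2 ^ (K + 1)) ^ 4) (2 ^ (K + 1) * (2 ^ (K + 1) - 1) ^ 2) D c)
      (evalForm (2 ^ (K + 1)) ((2 ^ (K + 1) - 1) ^ 2) D d) = true) :
    ∃ c' : ℕ → ℚ, IsNormalized m c' ∧
      (∀ i, ∃ k : ℕ, (gleasonPoly (12 * m + 5) (3 * m + 2) c').coeff i = k) ∧
      ∀ i, ∃ k : ℕ, (shadowPoly (12 * m + 5) (3 * m + 1) c').coeff i = k := by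
  simp only [checkLists, Bool.and_eq_true, decide_eq_true_eq] at h
  obtain ⟨hcB, hdB, hW0, hS0, hWd, hSd, hW1, hS1, hWS⟩ := h
  have hcB := Nat.le_of_ble_eq_true hcB
  have hdB := Nat.le_of_ble_eq_true hdB
  have hWd := two_mul_digit_lt hWd
  have hSd := two_mul_digit_lt hSd
  have hW1 := Nat.eq_of_beq_eq_true hW1
  have hS1 := Nat.eq_of_beq_eq_true hS1
  have hWS := Nat.eq_of_beq_eq_true hWS
  have hd : d.length = 3 * m + 2 := by rw [← hs.1, hc]
  have hB : 1 ≤ 2 ^ (K + 1) := Nat.one_le_two_pow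
  have hB' : 1 < 2 ^ (K + 1) := Nat.one_lt_two_pow (by omega)
  generalize 2 ^ (K + 1) = B at *
  rw [evalForm_eq] at hW0 hWd hW1 hWS hS0 hSd hS1
  rw [evalForm_eq] at hWS
  have hcB : 4 * homForm 16 4 (c.map abs) < (B : ℤ) := by
    have := absFormDown_eq 0 c
    rw [hc, Nat.cast_zero, mul_zero, zero_add] at this
    rw [← this]
    exact_mod_cast hcB
  have hdB : 2 * homForm 1 4 (d.map abs) < (B : ℤ) := by
    rw [← absFormUp_eq]
    exact_mod_cast hdB
  set P : ℤ[X] := (1 + X) * homForm ((1 + X) ^ 4) (X * (1 - X) ^ 2) (c.map C) with hP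
  set Q : ℤ[X] := homForm X ((1 - X) ^ 2) (d.map C) with hQ
  have hCev : ∀ l : List ℤ, (l.map C).map (evalRingHom (B : ℤ)) = l := fun l => by
    rw [List.map_map]
    convert List.map_id l
    funext a; simp
  have hCev1 : ∀ l : List ℤ, (l.map C).map (evalRingHom (1 : ℤ)) = l := fun l => by
    rw [List.map_map]
    convert List.map_id l
    funext a; simp
  have hB1 : ((B - 1 : ℕ) : ℤ) ^ 2 = (1 - (B : ℤ)) ^ 2 := by
    rw [Nat.cast_sub hB]; push_cast; ring
  have evP : P.eval (B : ℤ) = ((1 + B : ℕ) : ℤ) *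
      homForm (((1 + B) ^ 4 : ℕ) : ℤ) ((B * (B - 1) ^ 2 : ℕ) : ℤ) c := by
    rw [hP, eval_mul, ← coe_evalRingHom, map_homForm, hCev, Nat.cast_mul, Nat.cast_pow (B - 1), hB1]
    simp
  have evQ : Q.eval (B : ℤ) = homForm (B : ℤ) (((B - 1) ^ 2 : ℕ) : ℤ) d := by
    rw [hQ, ← coe_evalRingHom, map_homForm, hCev, Nat.cast_pow (B - 1), hB1]
    simp
  rw [← evP] at hW0 hWd hW1 hWS
  rw [← evQ] at hS0 hSd hS1 hWS
  -- Replacing each coefficient by its absolute value and `1 - X` by `1 + X` gives a dominating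
  -- polynomial, whose value at 1 is `2 * homForm 16 4 (c.map abs)`.
  have bP : ∀ j, 2 * |P.coeff j| < (B : ℤ) := fun j => by
    have h1 : Dominates ((1 + X) * homForm ((1 + X) ^ 4) (X * (1 + X) ^ 2) ((c.map abs).map C)) P :=
      (dominates_one.add dominates_X).mul
        (((dominates_one.add dominates_X).pow 4).homForm
          (dominates_X.mul (dominates_one_sub_X.pow 2)) c)
    have h2 := h1.abs_coeff_le_eval j
    rw [eval_mul, ← coe_evalRingHom, map_homForm, hCev1] at h2
    norm_num at h2
    linarith
  have bQ : ∀ j, 2 * |Q.coeff j| < (B : ℤ) := fun j => by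
    have h1 : Dominates (homForm X ((1 + X) ^ 2) ((d.map abs).map C)) Q :=
      dominates_X.homForm (dominates_one_sub_X.pow 2) d
    have h2 := h1.abs_coeff_le_eval j
    rw [← coe_evalRingHom, map_homForm, hCev1] at h2
    norm_num at h2
    linarith
  have cP : ∀ i, P.coeff i = (((P.eval (B : ℤ)).toNat / B ^ i % B : ℕ) : ℤ) := fun i =>
    coeff_eq_digit i bP (Int.toNat_of_nonneg hW0).symm hWd
  have cQ : ∀ i, Q.coeff i = (((Q.eval (B : ℤ)).toNat / B ^ i % B : ℕ) : ℤ) := fun i =>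
    coeff_eq_digit i bQ (Int.toNat_of_nonneg hS0).symm hSd
  have cP0 := fun {i} => coeff_eq_of_mod_eq_one (i := i) hB' cP hW1
  have cQ0 := fun {i} => coeff_eq_of_mod_eq_one (i := i) hB' cQ hS1
  have eW := gleasonPoly_eq_map m c hc
  have eS := shadowPoly_eq_map m (fun j => (c.getD j 0 : ℚ)) d hd
    hs.shadowScale_mul_eq
  rw [← hP] at eW
  rw [← hQ] at eS
  refine ⟨fun j => (c.getD j 0 : ℚ), ⟨?_, ?_, ?_, ?_, ?_⟩, ?_, ?_⟩
  · rw [eW, coeff_map, cP0 (by omega), if_pos rfl]; simp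
  · intro i h1 h2
    rw [eW, coeff_map, cP0 (by omega), if_neg (by omega)]; simp
  · rw [eS, coeff_map, cQ0 (by omega), if_pos rfl]; simp
  · intro i h1 h2
    rw [eS, coeff_map, cQ0 (by omega), if_neg (by omega)]; simp
  · rw [eW, eS, coeff_map, coeff_map, cP, cQ, hWS]
  · intro i
    exact ⟨_, by rw [eW, coeff_map, cP]; exact Int.cast_natCast _⟩
  · intro i
    exact ⟨_, by rw [eS, coeff_map, cQ]; exact Int.cast_natCast _⟩

/-- The Gleason coefficients `c_j, c_{j+1}, …` with `j ≤ 2m`, by their three-term recurrence. -/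
def lowCoeffs (k : ℕ) : ℕ → ℕ → ℤ → ℤ → List ℤ
  | 0, _, _, _ => []
  | n + 1, j, a, b => a :: lowCoeffs k n (j + 1) b
      (((2 * (k - 4 * j) * (k - 4 * j - 1) * (k - 4 * j - 2) * (k - 4 * j - 3) : ℕ) * a +
        Int.subNatNat ((j + 1) * (((64 * j + 116) * j + 61) * k + 2 * k ^ 3))
          ((j + 1) * (((64 * j + 192) * j + 206) * j + 78 + (12 * j + 15) * k ^ 2)) * b)
        / ((j + 1) * (j + 2) * (2 * j + 3) * (k - 2 - j) : ℕ))

theorem length_lowCoeffs (k n j : ℕ) (a b : ℤ) : (lowCoeffs k n j a b).length = n := by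
  induction n generalizing j a b with
  | zero => rfl
  | succ n ih => rw [lowCoeffs, List.length_cons, ih]

/-- The shadow coefficients `d_{2m+1}, …, d_{3m+1}`, by their two-term recurrence. -/
def highCoeffs (m : ℕ) : ℕ → ℕ → ℕ → List ℕ → List ℕ
  -- The last entry `d_{2m+1}` has its own ratio because `b_m` contributes to it.
  | 0, _, a, l => (a * (5 * m + 2) / (3 * m + 1)) :: l
  | n + 1, i, a, l =>
    highCoeffs m n (i + 1)
      (a * ((6 * m + 2 - 2 * i) * (6 * m + 1 - 2 * i)) / ((6 * m + 1 - i) * (i + 1))) (a :: l)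

theorem length_highCoeffs (m n i a : ℕ) (l : List ℕ) :
    (highCoeffs m n i a l).length = n + 1 + l.length := by
  induction n generalizing i a l with
  | zero => rw [highCoeffs, List.length_cons]; ring
  | succ n ih => rw [highCoeffs, ih, List.length_cons]; ring

/-- `checkLists` for given halves of the coefficient lists. -/
def checkHalves (m K D : ℕ) (l : List ℤ) (h : List ℕ) : Bool :=
  checkLists m K (l ++ scaleUp true 1 h)
    (scaleDown false (12 * m + 5) l ++ h.map fun a : ℕ => (a : ℤ))
    ((1 + 2 ^ (K + 1) : ℕ) * evalForm ((1 + 2 ^ (K + 1)) ^ 4)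
      (2 ^ (K + 1) * (2 ^ (K + 1) - 1) ^ 2) D (l ++ scaleUp true 1 h))
    (evalForm (2 ^ (K + 1)) ((2 ^ (K + 1) - 1) ^ 2) D
      (scaleDown false (12 * m + 5) l ++ h.map fun a : ℕ => (a : ℤ)))

/-- The numerical certificate for `m`. -/
def certificate (m : ℕ) : Bool :=
  checkHalves m (15 * m + 16) (Nat.log2 (3 * m + 2) - 2)
    (lowCoeffs (12 * m + 5) (2 * m + 1) 0 1 (-(12 * m + 5 : ℕ))) (highCoeffs m m 0 1 [])

/-- The recurrences that produce the lists need no proof: only the lengths and the scaling between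
the lists are used, and the check does the rest. The low half is computed as `c_j` and scaled to
`d_j`, the high half as `d_j` and scaled to `c_j`, so that all entries are integers. -/
theorem exists_isNormalized_of_certificate {m : ℕ} (hm : 1 ≤ m) (h : certificate m = true) :
    ∃ c : ℕ → ℚ, IsNormalized m c ∧
      (∀ i, ∃ k : ℕ, (gleasonPoly (12 * m + 5) (3 * m + 2) c).coeff i = k) ∧
      ∀ i, ∃ k : ℕ, (shadowPoly (12 * m + 5) (3 * m + 1) c).coeff i = k := by
  have hl := length_lowCoeffs (12 * m + 5) (2 * m + 1) 0 1 (-(12 * m + 5 : ℕ))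
  have hh := length_highCoeffs m m 0 1 []
  rw [certificate, checkHalves] at h
  generalize 15 * m + 16 = K at h
  generalize Nat.log2 (3 * m + 2) - 2 = D at h
  generalize lowCoeffs (12 * m + 5) (2 * m + 1) 0 1 (-(12 * m + 5 : ℕ)) = l at *
  generalize highCoeffs m m 0 1 [] = u at *
  -- The high half begins at the odd index `2m+1`, where `6(2m+1) - (12m+5) = 1`: hence the negative
  -- sign and the exponent 1.
  have hs' : ScaledLists (-2 ^ (12 * m + 5)) (64 ^ (2 * m + 1) * 1) (scaleUp true 1 u)
      (u.map fun a : ℕ => (a : ℤ)) := by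
    refine (scaledLists_scaleUp ?_ u).2
    rw [show (64 : ℤ) = 2 ^ 6 by norm_num, ← pow_mul, mul_one, ← pow_add]
    congr 1
    ring
  have hs : ScaledLists (2 ^ (12 * m + 5)) 1 (l ++ scaleUp true 1 u)
      (scaleDown false (12 * m + 5) l ++ u.map fun a : ℕ => (a : ℤ)) := by
    refine ScaledLists.scaleDown_append (by ring) (by rw [hl]; omega) ?_
    rw [hl, Odd.neg_one_pow ⟨m, rfl⟩, neg_one_mul]
    exact hs'
  refine exists_isNormalized_of_checkLists (K := K) (D := D) hm hs ?_ h
  rw [List.length_append, hs'.1, List.length_map, hl, hh]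
  simp; ring

set_option maxHeartbeats 0 in
theorem certificate_eq_true {m : ℕ} (h1 : 1 ≤ m) (h2 : m ≤ 159) : certificate m = true := by
  -- The 159 certificates are evaluated by the kernel.
  interval_cases m <;> decide +kernel

/-! ### Gleason's theorem in one variable -/

/-- The functional equation satisfied by the weight enumerator `f(y^2)` of a self-dual code of length
`2k`. -/
def IsMacWilliamsInvariant (k : ℕ) (f : ℚ[X]) : Prop :=
  ∀ y : ℚ, 1 < y → 2 ^ k * f.eval (y ^ 2) = (1 + y) ^ (2 * k) * f.eval (((1 - y) / (1 + y)) ^ 2)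

theorem eq_of_eval_eq_of_one_lt {p q : ℚ[X]} (h : ∀ y : ℚ, 1 < y → p.eval y = q.eval y) : p = q :=
  eq_of_infinite_eval_eq p q ((Set.Ioi_infinite (1 : ℚ)).mono h)

theorem eval_div_sq_eq_sum {k : ℕ} {f : ℚ[X]} (hf : f.natDegree ≤ k) {a : ℚ} (ha : a ≠ 0) (b : ℚ) :
    a ^ (2 * k) * f.eval ((b / a) ^ 2) =
      ∑ i ∈ Finset.range (k + 1), f.coeff i * (a ^ (2 * (k - i)) * b ^ (2 * i)) := by
  rw [eval_eq_sum_range' (Nat.lt_succ_of_le hf), Finset.mul_sum]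
  refine Finset.sum_congr rfl fun i hi => ?_
  obtain ⟨e, rfl⟩ := Nat.exists_eq_add_of_le (Finset.mem_range_succ_iff.1 hi)
  rw [Nat.add_sub_cancel_left, mul_add, pow_add, ← pow_mul, div_pow]
  field_simp

theorem IsMacWilliamsInvariant.comp_eq {k : ℕ} {f : ℚ[X]} (h : IsMacWilliamsInvariant k f)
    (hf : f.natDegree ≤ k) :
    C (2 ^ k) * f.comp (X ^ 2) = ∑ i ∈ Finset.range (k + 1),
      C (f.coeff i) * ((1 + X) ^ (2 * (k - i)) * (1 - X) ^ (2 * i)) := by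
  refine eq_of_eval_eq_of_one_lt fun y hy => ?_
  rw [eval_mul, eval_C, eval_comp, eval_pow, eval_X, h y hy,
    eval_div_sq_eq_sum hf (by linarith : 1 + y ≠ 0), eval_finsetSum]
  simp

theorem IsMacWilliamsInvariant.sub {k : ℕ} {f g : ℚ[X]} (hf : IsMacWilliamsInvariant k f)
    (hg : IsMacWilliamsInvariant k g) : IsMacWilliamsInvariant k (f - g) := fun y hy => by
  rw [eval_sub, eval_sub, mul_sub, mul_sub, hf y hy, hg y hy]

theorem isMacWilliamsInvariant_C_mul_one_add_X_pow (k : ℕ) (a : ℚ) :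
    IsMacWilliamsInvariant k (C a * (1 + X) ^ k) := fun y hy => by
  have : 1 + y ≠ 0 := by linarith
  simp only [eval_mul, eval_C, eval_pow, eval_add, eval_one, eval_X]
  rw [pow_mul, mul_left_comm, ← mul_pow, mul_left_comm, ← mul_pow]
  congr 2
  field_simp
  ring

/-- The identity `comp_eq` turns the vanishing of `f` at 0 into a double zero at 1 and lowers the
degree by one. The cofactor therefore has degree at most `k - 4`. -/
theorem IsMacWilliamsInvariant.exists_eq_mul {k : ℕ} {f : ℚ[X]} (h : IsMacWilliamsInvariant k f)
    (hf : f.natDegree ≤ k) (h0 : f.coeff 0 = 0) :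
    ∃ g : ℚ[X], f = X * (1 - X) ^ 2 * g ∧ (g ≠ 0 → g.natDegree + 4 ≤ k) := by
  have hc := h.comp_eq hf
  have h1 : f.eval 1 = 0 := by
    have := congrArg (eval 1) hc
    rw [Finset.sum_range_succ', h0] at this
    simpa [eval_finsetSum] using this
  -- At `y = -1` only the term `i = k` survives on the right, while the left is a multiple of `f(1)
  -- = 0`.
  have hk : f.coeff k = 0 := by
    have := congrArg (eval (-1)) hc
    rw [Finset.sum_range_succ, eval_add, eval_finsetSum, Finset.sum_eq_zero] at this
    · norm_num [eval_comp, h1] at this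
      exact this
    · intro i hi
      have hi' := Finset.mem_range.1 hi
      simp [show k - i ≠ 0 by omega]
  -- Without the term `i = 0` the right side is divisible by `(1-y)²`, and the derivative of `f(y²)`
  -- at 1 is `2f'(1)`.
  have hd : (derivative f).eval 1 = 0 := by
    obtain ⟨q, hq⟩ : (1 - X : ℚ[X]) ^ 2 ∣ C (2 ^ k) * f.comp (X ^ 2) := by
      rw [hc]
      refine Finset.dvd_sum fun i _ => ?_
      rcases Nat.eq_zero_or_pos i with rfl | hi
      · simp [h0]
      · exact ((pow_dvd_pow _ (by omega)).mul_left _).mul_left _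
    have := congrArg (fun p => (derivative p).eval 1) hq
    simpa [derivative_comp, eval_comp, derivative_pow] using this
  obtain ⟨f1, rfl⟩ := X_dvd_iff.2 h0
  rw [eval_mul, eval_X, one_mul] at h1
  obtain ⟨f2, rfl⟩ := dvd_iff_isRoot.2 (show IsRoot f1 1 from h1)
  have h2 : f2.eval 1 = 0 := by simpa using hd
  obtain ⟨g, rfl⟩ := dvd_iff_isRoot.2 (show IsRoot f2 1 from h2)
  refine ⟨g, by rw [C_1]; ring, fun hg => ?_⟩
  have hne : (X - C 1 : ℚ[X]) ≠ 0 := X_sub_C_ne_zero 1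
  have hdeg : (X * ((X - C 1) * ((X - C 1) * g)) : ℚ[X]).natDegree = g.natDegree + 3 := by
    rw [natDegree_mul X_ne_zero (mul_ne_zero hne (mul_ne_zero hne hg)),
      natDegree_mul hne (mul_ne_zero hne hg),
      natDegree_mul hne hg, natDegree_X, natDegree_X_sub_C]
    ring
  have hlt : (X * ((X - C 1) * ((X - C 1) * g)) : ℚ[X]).natDegree ≠ k := fun hk' => by
    rw [← hk', coeff_natDegree, leadingCoeff_eq_zero] at hk
    exact mul_ne_zero X_ne_zero (mul_ne_zero hne (mul_ne_zero hne hg)) hk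
  omega

/-- The factor `z(1-z)²` is itself invariant for `k = 4`, and its value at `z = y²` is nonzero for
`y > 1`, so it cancels. -/
theorem IsMacWilliamsInvariant.of_mul {k : ℕ} {g : ℚ[X]}
    (h : IsMacWilliamsInvariant (k + 4) (X * (1 - X) ^ 2 * g)) : IsMacWilliamsInvariant k g := by
  intro y hy
  have h1 := h y hy
  have hy1 : 1 + y ≠ 0 := by linarith
  have hne : 16 * y ^ 2 * (1 - y ^ 2) ^ 2 ≠ 0 := by
    have : 1 - y ^ 2 ≠ 0 := by nlinarith
    have : y ≠ 0 := by linarith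
    positivity
  simp only [eval_mul, eval_X, eval_pow, eval_sub, eval_one] at h1
  generalize eval (((1 - y) / (1 + y)) ^ 2) g = t at *
  have e : (1 + y) ^ 8 * (((1 - y) / (1 + y)) ^ 2 * (1 - ((1 - y) / (1 + y)) ^ 2) ^ 2) =
      16 * y ^ 2 * (1 - y ^ 2) ^ 2 := by
    field_simp
    ring
  apply mul_left_cancel₀ hne
  have e8 : 2 * (k + 4) = 2 * k + 8 := by ring
  rw [e8, pow_add, pow_add] at h1
  linear_combination h1 + (1 + y) ^ (2 * k) * t * e

/-- Gleason's theorem for singly even self-dual codes, in one variable. -/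
theorem IsMacWilliamsInvariant.exists_gleasonPoly {k : ℕ} {f : ℚ[X]}
    (h : IsMacWilliamsInvariant k f) (hf : f.natDegree ≤ k) :
    ∃ c : ℕ → ℚ, f = gleasonPoly k (k / 4 + 1) c := by
  induction k using Nat.strong_induction_on generalizing f with
  | _ k ih =>
    have hd : (C (f.coeff 0) * (1 + X) ^ k : ℚ[X]).natDegree ≤ k := by
      refine (natDegree_C_mul_le _ _).trans (natDegree_pow_le.trans ?_)
      rw [add_comm, ← C_1, natDegree_X_add_C, mul_one]
    -- Subtracting `f(0)(1+z)^k` leaves an invariant with zero constant term; its cofactor is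
    -- invariant for `k - 4`.
    obtain ⟨g, hg, hgk⟩ := (h.sub (isMacWilliamsInvariant_C_mul_one_add_X_pow k
      (f.coeff 0))).exists_eq_mul ((natDegree_sub_le _ _).trans (max_le hf hd))
      (by simp [coeff_zero_eq_eval_zero])
    have hg' := sub_eq_iff_eq_add'.1 hg
    obtain rfl | hg0 := eq_or_ne g 0
    · refine ⟨fun j => if j = 0 then f.coeff 0 else 0, ?_⟩
      rw [gleasonPoly, Finset.sum_eq_single 0]
      · conv_lhs => rw [hg']
        simp [gleasonTerm]
      · intro j _ hj
        simp [hj]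
      · simp
    · obtain ⟨e, rfl⟩ := Nat.exists_eq_add_of_le' ((Nat.le_add_left _ _).trans (hgk hg0))
      have hinv : IsMacWilliamsInvariant (e + 4) (X * (1 - X) ^ 2 * g) := by
        have := h.sub (isMacWilliamsInvariant_C_mul_one_add_X_pow (e + 4) (f.coeff 0))
        rwa [hg] at this
      obtain ⟨c, hc⟩ := ih e (by omega) hinv.of_mul (by have := hgk hg0; omega)
      refine ⟨fun j => if j = 0 then f.coeff 0 else c (j - 1), ?_⟩
      refine hg'.trans ?_
      rw [gleasonPoly, show (e + 4) / 4 + 1 = e / 4 + 1 + 1 by omega, Finset.sum_range_succ']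
      conv_lhs => rw [hc, gleasonPoly, Finset.mul_sum, add_comm]
      refine congrArg₂ _ (Finset.sum_congr rfl fun j _ => ?_) ?_
      · simp only [gleasonTerm, Nat.add_eq_zero_iff, one_ne_zero, and_false, if_false,
          Nat.add_sub_cancel]
        rw [show e + 4 - 4 * (j + 1) = e - 4 * j by omega, pow_succ]
        ring
      · simp [gleasonTerm]

/-! ### Characters and the MacWilliams identity -/

variable {n : ℕ}

theorem zmod_two_eq_zero_or_one (a : ZMod 2) : a = 0 ∨ a = 1 := by
  revert a
  decide

theorem zmod_two_eq_one {a : ZMod 2} (h : a ≠ 0) : a = 1 :=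
  (zmod_two_eq_zero_or_one a).resolve_left h

theorem exists_hammingNorm_add (x y : Word n) :
    ∃ k : ℕ, hammingNorm (x + y) + 2 * k = hammingNorm x + hammingNorm y ∧
      x ⬝ᵥ y = (k : ZMod 2) := by
  -- `k` is the size of the common support.
  refine ⟨∑ i, if x i ≠ 0 ∧ y i ≠ 0 then 1 else 0, ?_, ?_⟩
  · simp only [hammingNorm, Finset.card_filter]
    rw [Finset.mul_sum, ← Finset.sum_add_distrib, ← Finset.sum_add_distrib]
    refine Finset.sum_congr rfl fun i _ => ?_
    rw [Pi.add_apply]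
    rcases zmod_two_eq_zero_or_one (x i) with hx | hx <;>
      rcases zmod_two_eq_zero_or_one (y i) with hy | hy <;>
        simp [hx, hy, CharTwo.add_self_eq_zero]
  · rw [dotProduct, Nat.cast_sum]
    refine Finset.sum_congr rfl fun i _ => ?_
    rcases zmod_two_eq_zero_or_one (x i) with hx | hx <;>
      rcases zmod_two_eq_zero_or_one (y i) with hy | hy <;> simp [hx, hy]

theorem dotProduct_self_eq_hammingNorm (x : Word n) : x ⬝ᵥ x = (hammingNorm x : ZMod 2) := by
  simp only [dotProduct, hammingNorm, Finset.card_filter, Nat.cast_sum]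
  refine Finset.sum_congr rfl fun i _ => ?_
  rcases zmod_two_eq_zero_or_one (x i) with hx | hx <;> simp [hx]

/-- The nontrivial additive character of `ZMod 2`. -/
def sign (a : ZMod 2) : ℚ := if a = 0 then 1 else -1

theorem sign_add (a b : ZMod 2) : sign (a + b) = sign a * sign b := by
  have : ∀ a b : ZMod 2, (if a + b = 0 then 1 else -1 : ℤ) =
      (if a = 0 then 1 else -1) * if b = 0 then 1 else -1 := by decide
  unfold sign
  exact_mod_cast this a b

theorem sign_sum {ι : Type*} (s : Finset ι) (f : ι → ZMod 2) :
    sign (∑ i ∈ s, f i) = ∏ i ∈ s, sign (f i) := by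
  classical
  induction s using Finset.induction_on with
  | empty => simp [sign]
  | insert a s ha ih => rw [Finset.sum_insert ha, Finset.prod_insert ha, sign_add, ih]

theorem pow_hammingNorm_eq_prod (y : ℚ) (v : Word n) :
    y ^ hammingNorm v = ∏ i, if v i = 0 then 1 else y := by
  rw [hammingNorm, ← Finset.prod_const, Finset.prod_filter]
  refine Finset.prod_congr rfl fun i _ => ?_
  by_cases h : v i = 0 <;> simp [h]

/-- Both the character and the weight are products over coordinates, so the sum factors into sums
over `ZMod 2`. -/
theorem sum_sign_dotProduct_mul_pow (y : ℚ) (u : Word n) :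
    ∑ v : Word n, sign (u ⬝ᵥ v) * y ^ hammingNorm v =
      (1 + y) ^ (n - hammingNorm u) * (1 - y) ^ hammingNorm u := by
  have h1 : ∀ v : Word n, sign (u ⬝ᵥ v) * y ^ hammingNorm v =
      ∏ i, sign (u i * v i) * if v i = 0 then 1 else y := fun v => by
    rw [dotProduct, sign_sum, pow_hammingNorm_eq_prod, Finset.prod_mul_distrib]
  have h2 : ∀ a : ZMod 2, ∑ b : ZMod 2, sign (a * b) * (if b = 0 then 1 else y) =
      if a = 0 then 1 + y else 1 - y := fun a => by
    have e : (Finset.univ : Finset (ZMod 2)) = {0, 1} := rfl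
    rw [e, Finset.sum_pair (by decide)]
    by_cases ha : a = 0
    · simp [ha, sign]
    · rw [zmod_two_eq_one ha]
      simp [sign]
      ring
  rw [Finset.sum_congr rfl fun v _ => h1 v]
  have h3 := Fintype.prod_sum (fun (i : Fin n) (b : ZMod 2) =>
    sign (u i * b) * if b = 0 then 1 else y)
  rw [← h3, Finset.prod_congr rfl fun i _ => h2 (u i), Finset.prod_ite, Finset.prod_const,
    Finset.prod_const, hammingNorm]
  congr 2
  have := Finset.card_filter_add_card_filter_not (s := (Finset.univ : Finset (Fin n)))
    (fun i => u i = 0)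
  rw [Finset.card_univ, Fintype.card_fin] at this
  simp only [ne_eq]
  omega

open Classical in
/-- The finset of the codewords. -/
noncomputable def words (s : Set (Word n)) : Finset (Word n) := Finset.univ.filter (· ∈ s)

theorem mem_words {s : Set (Word n)} {x : Word n} : x ∈ words s ↔ x ∈ s := by
  simp [words]

theorem eval_weightEnumerator (s : Set (Word n)) (y : ℚ) :
    (weightEnumerator s).eval y = ∑ x ∈ words s, y ^ hammingNorm x := by
  rw [weightEnumerator, eval_finsetSum]
  simp [words]

/-- Translation by `w` permutes `C` and changes the sign of the sum. -/
theorem sum_eq_zero_of_translate (C : Submodule (ZMod 2) (Word n)) {w : Word n} (hw : w ∈ C)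
    {φ : Word n → ℚ} (h : ∀ u ∈ C, φ (u + w) = -φ u) :
    ∑ u ∈ words (C : Set (Word n)), φ u = 0 := by
  have h1 : ∑ u ∈ words (C : Set (Word n)), φ u = ∑ u ∈ words (C : Set (Word n)), φ (u + w) := by
    refine (Finset.sum_bij (fun u _ => u + w) ?_ ?_ ?_ ?_).symm
    · exact fun u hu => mem_words.2 (C.add_mem (mem_words.1 hu) hw)
    · exact fun u _ v _ huv => add_right_cancel huv
    · exact fun u hu => ⟨u - w, mem_words.2 (C.sub_mem (mem_words.1 hu) hw), sub_add_cancel u w⟩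
    · exact fun u _ => rfl
  rw [Finset.sum_congr rfl fun u hu => h u (mem_words.1 hu), Finset.sum_neg_distrib] at h1
  linarith

theorem mem_dual {s : Set (Word n)} {x : Word n} : x ∈ dual s ↔ ∀ y ∈ s, x ⬝ᵥ y = 0 := Iff.rfl

theorem sum_sign_dotProduct (C : Submodule (ZMod 2) (Word n)) (v : Word n) :
    ∑ u ∈ words (C : Set (Word n)), sign (u ⬝ᵥ v) =
      if v ∈ words (dual (C : Set (Word n)) : Set (Word n)) then
        ((words (C : Set (Word n))).card : ℚ) else 0 := by
  split_ifs with h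
  · rw [mem_words, SetLike.mem_coe, mem_dual] at h
    rw [Finset.sum_congr rfl fun u hu => ?_, Finset.sum_const, nsmul_one]
    rw [dotProduct_comm, h u (mem_words.1 hu), sign, if_pos rfl]
  · rw [mem_words, SetLike.mem_coe, mem_dual] at h
    push Not at h
    obtain ⟨w, hw, hvw⟩ := h
    refine sum_eq_zero_of_translate C hw fun u _ => ?_
    rw [add_dotProduct, sign_add, dotProduct_comm w, sign.eq_1 (v ⬝ᵥ w), if_neg hvw]
    ring

/-- The MacWilliams identity. -/
theorem macWilliams (C : Submodule (ZMod 2) (Word n)) (y : ℚ) :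
    ∑ u ∈ words (C : Set (Word n)), (1 + y) ^ (n - hammingNorm u) * (1 - y) ^ hammingNorm u =
      (words (C : Set (Word n))).card *
        (weightEnumerator (dual (C : Set (Word n)) : Set (Word n))).eval y := by
  rw [Finset.sum_congr rfl fun u _ => (sum_sign_dotProduct_mul_pow y u).symm, Finset.sum_comm,
    eval_weightEnumerator, Finset.mul_sum]
  simp only [← Finset.sum_mul, sum_sign_dotProduct, ite_mul, zero_mul]
  rw [Finset.sum_ite_mem, Finset.univ_inter]

/-! ### Self-dual codes -/

section SelfDual

variable {C : Submodule (ZMod 2) (Word n)}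

theorem dotProduct_eq_zero (hC : C = dual (C : Set (Word n))) {x y : Word n} (hx : x ∈ C)
    (hy : y ∈ C) : x ⬝ᵥ y = 0 := by
  rw [hC] at hx
  exact hx y hy

theorem even_hammingNorm (hC : C = dual (C : Set (Word n))) {x : Word n} (hx : x ∈ C) :
    2 ∣ hammingNorm x := by
  rw [← ZMod.natCast_eq_zero_iff, ← dotProduct_self_eq_hammingNorm, dotProduct_eq_zero hC hx hx]

theorem four_dvd_hammingNorm_add_iff (hC : C = dual (C : Set (Word n))) {x y : Word n} (hx : x ∈ C)
    (hy : y ∈ C) : 4 ∣ hammingNorm (x + y) ↔ (4 ∣ hammingNorm x ↔ 4 ∣ hammingNorm y) := by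
  obtain ⟨k, hk, hxy⟩ := exists_hammingNorm_add x y
  have h1 := even_hammingNorm hC hx
  have h2 := even_hammingNorm hC hy
  rw [dotProduct_eq_zero hC hx hy, eq_comm, ZMod.natCast_eq_zero_iff] at hxy
  omega

/-- The doubly even subcode as a subspace. -/
def doublyEvenSubcode (hC : C = dual (C : Set (Word n))) : Submodule (ZMod 2) (Word n) where
  carrier := doublyEvenPart C
  zero_mem' := ⟨C.zero_mem, by simp⟩
  add_mem' := fun {a b} ha hb =>
    ⟨C.add_mem ha.1 hb.1, (four_dvd_hammingNorm_add_iff hC ha.1 hb.1).2 (by simp [ha.2, hb.2])⟩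
  smul_mem' := fun c x hx => ⟨C.smul_mem c hx.1, by
    rcases zmod_two_eq_zero_or_one c with rfl | rfl
    · simp
    · simpa using hx.2⟩

theorem coe_doublyEvenSubcode (hC : C = dual (C : Set (Word n))) :
    (doublyEvenSubcode hC : Set (Word n)) = doublyEvenPart C := rfl

/-- The indicator of `C_0` on `C` is half the sum of the constant 1 and the sign that is 1 exactly
on `C_0`. -/
theorem sum_words_doublyEvenPart (C : Submodule (ZMod 2) (Word n)) (f : Word n → ℚ) :
    2 * ∑ u ∈ words (doublyEvenPart C), f u = ∑ u ∈ words (C : Set (Word n)), f u +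
      ∑ u ∈ words (C : Set (Word n)), (if 4 ∣ hammingNorm u then 1 else -1) * f u := by
  have : words (doublyEvenPart C) =
      (words (C : Set (Word n))).filter fun u => 4 ∣ hammingNorm u := by
    ext u
    rw [Finset.mem_filter, mem_words, mem_words]
    rfl
  rw [this, ← Finset.sum_add_distrib, Finset.sum_filter, Finset.mul_sum]
  refine Finset.sum_congr rfl fun u _ => ?_
  split_ifs <;> ring

theorem IsSinglyEvenSelfDual.two_mul_card (hC : IsSinglyEvenSelfDual C) :
    2 * ((words (doublyEvenPart C)).card : ℚ) = (words (C : Set (Word n))).card := by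
  obtain ⟨hC, w, hw, hw2⟩ := hC
  have h := sum_words_doublyEvenPart C fun _ => 1
  rw [sum_eq_zero_of_translate C hw
    (φ := fun u => (if 4 ∣ hammingNorm u then 1 else -1) * 1)] at h
  · simpa using h
  · intro u hu
    have := four_dvd_hammingNorm_add_iff hC hu hw
    have h4 : ¬ 4 ∣ hammingNorm w := by omega
    by_cases h : 4 ∣ hammingNorm u <;> simp [this, h, h4]

theorem eval_weightEnumerator_dual_doublyEvenPart (hC : C = dual (C : Set (Word n))) (y : ℚ) :
    (weightEnumerator (dual (doublyEvenPart C) : Set (Word n))).eval y =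
      (weightEnumerator (C : Set (Word n))).eval y + (weightEnumerator (shadow C)).eval y := by
  classical
  have : words (dual (doublyEvenPart C) : Set (Word n)) =
      words (C : Set (Word n)) ∪ words (shadow C) := by
    ext x
    rw [Finset.mem_union, mem_words, mem_words, mem_words, shadow, Set.mem_sdiff]
    have : x ∈ (C : Set (Word n)) → x ∈ (dual (doublyEvenPart C) : Set (Word n)) :=
      fun hx y hy => dotProduct_eq_zero hC hx hy.1
    tauto
  rw [eval_weightEnumerator, this, Finset.sum_union, eval_weightEnumerator, eval_weightEnumerator]
  rw [Finset.disjoint_left]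
  intro x hx hx'
  exact (mem_words.1 hx').2 (mem_words.1 hx)

/-- The MacWilliams identity for the shadow. -/
theorem IsSinglyEvenSelfDual.card_mul_eval_shadow (hC : IsSinglyEvenSelfDual C) (y : ℚ) :
    (words (C : Set (Word n))).card * (weightEnumerator (shadow C)).eval y =
      ∑ u ∈ words (C : Set (Word n)), (if 4 ∣ hammingNorm u then 1 else -1) *
        ((1 + y) ^ (n - hammingNorm u) * (1 - y) ^ hammingNorm u) := by
  have h1 := macWilliams C y
  have h2 := macWilliams (doublyEvenSubcode hC.1) y
  rw [← hC.1] at h1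
  rw [coe_doublyEvenSubcode, eval_weightEnumerator_dual_doublyEvenPart hC.1] at h2
  have h3 := sum_words_doublyEvenPart C
    fun u => (1 + y) ^ (n - hammingNorm u) * (1 - y) ^ hammingNorm u
  rw [h1, h2] at h3
  linear_combination h3 -
    ((weightEnumerator (C : Set (Word n))).eval y + (weightEnumerator (shadow C)).eval y) *
      hC.two_mul_card

/-- At `y = 1` only the zero word contributes to the MacWilliams sum, so `2^n = |C|²`. -/
theorem card_words_eq {k : ℕ} (hn : n = 2 * k) (hC : C = dual (C : Set (Word n))) :
    ((words (C : Set (Word n))).card : ℚ) = 2 ^ k := by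
  have h := macWilliams C 1
  rw [← hC, eval_weightEnumerator, Finset.sum_eq_single 0] at h
  · simp only [one_pow, Finset.sum_const, nsmul_one, hammingNorm_zero, pow_zero, mul_one,
      Nat.sub_zero] at h
    have h2 : (1 + 1 : ℚ) ^ n = (2 ^ k) ^ 2 := by rw [hn, pow_mul']; norm_num
    rw [h2, ← sq] at h
    exact ((pow_left_inj₀ (pow_nonneg two_pos.le k) (Nat.cast_nonneg _) two_ne_zero).1 h).symm
  · intro u _ hu
    simp [hu]
  · intro h0
    exact absurd (mem_words.2 C.zero_mem) h0

/-- The weight enumerator of an even code in the variable `y^2`. -/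
noncomputable def halfEnumerator (C : Submodule (ZMod 2) (Word n)) : ℚ[X] :=
  ∑ u ∈ words (C : Set (Word n)), X ^ (hammingNorm u / 2)

theorem weightEnumerator_eq_expand (hC : C = dual (C : Set (Word n))) :
    weightEnumerator (C : Set (Word n)) = expand ℚ 2 (halfEnumerator C) := by
  refine eq_of_eval_eq_of_one_lt fun y _ => ?_
  rw [eval_weightEnumerator, expand_eval, halfEnumerator, eval_finsetSum]
  refine Finset.sum_congr rfl fun u hu => ?_
  rw [eval_pow, eval_X, ← pow_mul, Nat.mul_div_cancel' (even_hammingNorm hC (mem_words.1 hu))]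

theorem natDegree_halfEnumerator_le {k : ℕ} (hn : n = 2 * k) (C : Submodule (ZMod 2) (Word n)) :
    (halfEnumerator C).natDegree ≤ k := by
  refine natDegree_sum_le_of_forall_le _ _ fun u _ => ?_
  rw [natDegree_X_pow]
  have := hammingNorm_le_card_fintype (x := u)
  rw [Fintype.card_fin] at this
  omega

/-- With `s = 1` this is the MacWilliams sum of `C`, with `s = -1` that of its shadow. -/
theorem one_add_pow_mul_eval_halfEnumerator {k : ℕ} (hn : n = 2 * k)
    (hC : C = dual (C : Set (Word n))) {y : ℚ} (hy : 1 < y) (s : ℚ) :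
    (1 + y) ^ (2 * k) * (halfEnumerator C).eval (s * ((1 - y) / (1 + y)) ^ 2) =
      ∑ u ∈ words (C : Set (Word n)), s ^ (hammingNorm u / 2) *
        ((1 + y) ^ (n - hammingNorm u) * (1 - y) ^ hammingNorm u) := by
  rw [halfEnumerator, eval_finsetSum, Finset.mul_sum]
  refine Finset.sum_congr rfl fun u hu => ?_
  obtain ⟨j, hj⟩ := even_hammingNorm hC (mem_words.1 hu)
  have := hammingNorm_le_card_fintype (x := u)
  rw [Fintype.card_fin] at this
  obtain ⟨e, rfl⟩ := Nat.exists_eq_add_of_le (show j ≤ k by omega)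
  rw [hj, Nat.mul_div_cancel_left _ two_pos, eval_pow, eval_X, mul_pow, ← pow_mul,
    show n - 2 * j = 2 * e by omega, mul_add, pow_add, div_pow]
  have : 1 + y ≠ 0 := by linarith
  field_simp

theorem isMacWilliamsInvariant_halfEnumerator {k : ℕ} (hn : n = 2 * k)
    (hC : C = dual (C : Set (Word n))) : IsMacWilliamsInvariant k (halfEnumerator C) := by
  intro y hy
  have h := macWilliams C y
  have h1 := one_add_pow_mul_eval_halfEnumerator hn hC hy 1
  simp only [one_pow, one_mul] at h1
  rw [h1, h, ← hC, weightEnumerator_eq_expand hC, expand_eval, card_words_eq hn hC]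

theorem eval_gleasonTerm_neg {k j : ℕ} (hj : 4 * j ≤ k) {y : ℚ} (hy : 1 < y) :
    (1 + y) ^ (2 * k) * (gleasonTerm k j).eval (-1 * ((1 - y) / (1 + y)) ^ 2) =
      (4 * y) ^ (k - 4 * j) * (-4 * (1 - y ^ 4) ^ 2) ^ j := by
  obtain ⟨e, rfl⟩ := Nat.exists_eq_add_of_le hj
  have hy1 : 1 + y ≠ 0 := by linarith
  have h1 : (1 + y) ^ 2 * (1 + -1 * ((1 - y) / (1 + y)) ^ 2) = 4 * y := by
    field_simp
    ring
  have h2 : (1 + y) ^ 8 * (-1 * ((1 - y) / (1 + y)) ^ 2 *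
      (1 - -1 * ((1 - y) / (1 + y)) ^ 2) ^ 2) = -4 * (1 - y ^ 4) ^ 2 := by
    field_simp
    ring
  rw [Nat.add_sub_cancel_left, ← h1, ← h2, mul_pow, mul_pow, gleasonTerm,
    Nat.add_sub_cancel_left]
  simp only [eval_mul, eval_pow, eval_add, eval_sub, eval_one, eval_X]
  generalize -1 * ((1 - y) / (1 + y)) ^ 2 = s
  generalize 1 + y = a
  ring

/-- Gleason's theorem for a singly even self-dual code together with its shadow. -/
theorem IsSinglyEvenSelfDual.isGleasonPair {k : ℕ} (hn : n = 2 * k)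
    (hC : IsSinglyEvenSelfDual C) :
    IsGleasonPair n (weightEnumerator (C : Set (Word n))) (weightEnumerator (shadow C)) := by
  obtain ⟨c, hc⟩ := (isMacWilliamsInvariant_halfEnumerator hn hC.1).exists_gleasonPoly
    (natDegree_halfEnumerator_le hn C)
  have e1 : n / 8 = k / 4 := by omega
  have e2 : n / 2 = k := by omega
  refine ⟨c, ?_, ?_⟩
  · rw [weightEnumerator_eq_expand hC.1, hc, expand_gleasonPoly, e1, e2]
  · refine eq_of_eval_eq_of_one_lt fun y hy => ?_
    have h1 := hC.card_mul_eval_shadow y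
    have h2 := one_add_pow_mul_eval_halfEnumerator hn hC.1 hy (-1)
    -- On `C` the sign separating `C_0` from its complement is `(-1)^(wt/2)`; this is the
    -- substitution `z ↦ -z`.
    have h3 : ∀ u ∈ words (C : Set (Word n)),
        ((-1) ^ (hammingNorm u / 2) : ℚ) = if 4 ∣ hammingNorm u then 1 else -1 := fun u hu => by
      obtain ⟨j, hj⟩ := even_hammingNorm hC.1 (mem_words.1 hu)
      rw [hj, Nat.mul_div_cancel_left _ two_pos, neg_one_pow_eq_ite]
      have : (4 ∣ 2 * j) ↔ Even j := by rw [even_iff_two_dvd]; omega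
      simp only [this]
    rw [Finset.sum_congr rfl fun u hu => by rw [h3 u hu], ← h1, card_words_eq hn hC.1, hc,
      gleasonPoly, eval_finsetSum, Finset.mul_sum] at h2
    have h4 : (2 : ℚ) ^ k ≠ 0 := by positivity
    apply mul_left_cancel₀ h4
    rw [← h2, eval_finsetSum, Finset.mul_sum, e1, e2]
    refine Finset.sum_congr rfl fun j hj => ?_
    have hj' : 4 * j ≤ k := by have := Finset.mem_range.1 hj; omega
    rw [eval_mul, eval_C, mul_left_comm, eval_gleasonTerm_neg hj' hy]
    simp only [eval_mul, eval_C, eval_pow, eval_X, eval_sub, eval_one]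
    obtain ⟨e, rfl⟩ := Nat.exists_eq_add_of_le hj'
    rw [Nat.add_sub_cancel_left, show ((4 * j + e : ℕ) : ℤ) - 6 * (j : ℤ) = (e : ℤ) - (2 * j : ℕ) by
      push_cast; ring, zpow_sub₀ (by norm_num), zpow_natCast, zpow_natCast, mul_pow, mul_pow,
      ← pow_mul, neg_pow, show (4 : ℚ) = 2 ^ 2 by norm_num, ← pow_mul, ← pow_mul, pow_add]
    field_simp
    ring

end SelfDual

/-! ### Codes with minimal shadow and the conclusion -/

variable {n : ℕ} {C : Submodule (ZMod 2) (Word n)}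

theorem word_add_self (x : Word n) : x + x = 0 := funext fun i => CharTwo.add_self_eq_zero (x i)

theorem word_add_add_cancel (x y : Word n) : x + y + y = x := by
  rw [add_assoc, word_add_self, add_zero]

theorem coeff_weightEnumerator (s : Set (Word n)) (i : ℕ) :
    (weightEnumerator s).coeff i = ((words s).filter fun x => hammingNorm x = i).card := by
  rw [weightEnumerator, finsetSum_coeff, Finset.card_filter, Nat.cast_sum]
  refine Finset.sum_congr (by ext; simp [words]) fun x _ => ?_
  rw [coeff_X_pow]
  by_cases h : hammingNorm x = i
  · simp [h]
  · simp [h, Ne.symm h]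

/-- A shadow vector orthogonal to some `u ∈ C \ C_0` would be orthogonal to `C_0` and `u + C_0`,
that is to all of `C`, and so would lie in `C`. -/
theorem dotProduct_of_mem_shadow (hC : C = dual (C : Set (Word n))) {x u : Word n}
    (hx : x ∈ shadow C) (hu : u ∈ C) : x ⬝ᵥ u = 0 ↔ 4 ∣ hammingNorm u := by
  refine ⟨fun h => ?_, fun h => hx.1 u ⟨hu, h⟩⟩
  by_contra h4
  refine hx.2 ?_
  rw [SetLike.mem_coe, hC]
  intro w hw
  by_cases hw4 : 4 ∣ hammingNorm w
  · exact hx.1 w ⟨hw, hw4⟩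
  · have h1 := hx.1 (w + u) ⟨C.add_mem hw hu,
      (four_dvd_hammingNorm_add_iff hC hw hu).2 (by simp [h4, hw4])⟩
    rwa [dotProduct_add, h, add_zero] at h1

theorem add_mem_of_mem_shadow (hC : C = dual (C : Set (Word n))) {x y : Word n}
    (hx : x ∈ shadow C) (hy : y ∈ shadow C) : x + y ∈ C := by
  rw [hC]
  intro u hu
  rw [add_dotProduct]
  have h1 := dotProduct_of_mem_shadow hC hx hu
  have h2 := dotProduct_of_mem_shadow hC hy hu
  by_cases h : x ⬝ᵥ u = 0
  · rw [h, h2.2 (h1.1 h), add_zero]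
  · rw [zmod_two_eq_one h, zmod_two_eq_one fun h' => h (h1.2 (h2.1 h'))]
    rfl

theorem add_mem_shadow (hC : C = dual (C : Set (Word n))) {x e : Word n}
    (hx : x ∈ C) (he : e ∈ shadow C) : x + e ∈ shadow C := by
  refine ⟨?_, fun h => he.2 ?_⟩
  · refine (dual (doublyEvenPart C)).add_mem (fun y hy => ?_) he.1
    exact dotProduct_eq_zero hC hx hy.1
  · rw [SetLike.mem_coe, ← C.add_mem_iff_right hx]
    exact h

theorem IsMinimalShadowCode.isEnumeratorPair {m : ℕ}
    {C : Submodule (ZMod 2) (Word (24 * m + 10))} (hm : 1 ≤ m) (h : IsMinimalShadowCode m C) :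
    IsEnumeratorPair m (weightEnumerator (C : Set (Word (24 * m + 10))))
      (weightEnumerator (shadow C)) := by
  obtain ⟨hC, ⟨-, -, hmin⟩, ⟨e, he, -, hwe⟩, -⟩ := h
  have hC1 := hC.1
  replace hwe : hammingNorm e = 1 := by
    rw [hwe, minimalShadowWeight, if_neg (by omega)]
    omega
  have hmin : ∀ x ∈ C, x ≠ 0 → 4 * m + 2 ≤ hammingNorm x := fun x hx hx0 => hmin ⟨x, hx, hx0, rfl⟩
  -- Otherwise `x + e` is a nonzero codeword of weight at most `4m+1`.
  have heq : ∀ x ∈ shadow C, hammingNorm x ≤ 4 * m → x = e := fun x hx hwx => by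
    by_contra hne
    obtain ⟨k, hk, -⟩ := exists_hammingNorm_add x e
    have := hmin (x + e) (add_mem_of_mem_shadow hC1 hx he) fun h0 => hne <| by
      rw [← word_add_add_cancel x e, h0, zero_add]
    omega
  refine ⟨hC.isGleasonPair (k := 12 * m + 5) (by ring), ?_, fun i h1 h2 => ?_, ?_,
    fun i h1 h2 => ?_, ?_⟩
  · rw [coeff_weightEnumerator, Nat.cast_eq_one, Finset.card_eq_one]
    refine ⟨0, Finset.ext fun x => ?_⟩
    rw [Finset.mem_filter, Finset.mem_singleton, mem_words, hammingNorm_eq_zero]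
    exact ⟨And.right, fun h => ⟨h ▸ C.zero_mem, h⟩⟩
  · rw [coeff_weightEnumerator, Nat.cast_eq_zero, Finset.card_eq_zero, Finset.filter_eq_empty_iff]
    intro x hx hwx
    have := hmin x (mem_words.1 hx) (by rintro rfl; rw [hammingNorm_zero] at hwx; omega)
    omega
  · rw [coeff_weightEnumerator, Nat.cast_eq_one, Finset.card_eq_one]
    refine ⟨e, Finset.ext fun x => ?_⟩
    rw [Finset.mem_filter, Finset.mem_singleton, mem_words]
    exact ⟨fun h => heq x h.1 (by omega), fun h => h ▸ ⟨he, hwe⟩⟩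
  · rw [coeff_weightEnumerator, Nat.cast_eq_zero, Finset.card_eq_zero, Finset.filter_eq_empty_iff]
    intro x hx hwx
    rw [heq x (mem_words.1 hx) (by omega)] at hwx
    omega
  · rw [coeff_weightEnumerator, coeff_weightEnumerator, Nat.cast_inj]
    -- Translation by `e` matches codewords of weight `4m+2` with shadow vectors of weight `4m+1`.
    refine Finset.card_bij' (fun x _ => x + e) (fun x _ => x + e) ?_ ?_
      (fun x _ => word_add_add_cancel x e) (fun x _ => word_add_add_cancel x e)
    · intro x hx
      rw [Finset.mem_filter, mem_words] at hx ⊢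
      refine ⟨add_mem_shadow hC1 hx.1 he, ?_⟩
      obtain ⟨k, hk, hxe⟩ := exists_hammingNorm_add x e
      obtain ⟨l, hl, -⟩ := exists_hammingNorm_add (x + e) e
      rw [word_add_add_cancel] at hl
      -- As 4 does not divide `4m+2`, the codeword is not orthogonal to `e`. So adding `e` lowers
      -- the weight, and by at most 1 according to `hl`.
      have h1 : ¬ 2 ∣ k := by
        rw [← ZMod.natCast_eq_zero_iff, ← hxe, dotProduct_comm,
          dotProduct_of_mem_shadow hC1 he hx.1]
        omega
      omega
    · intro x hx
      rw [Finset.mem_filter, mem_words] at hx ⊢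
      have hxe := add_mem_of_mem_shadow hC1 hx.1 he
      refine ⟨hxe, ?_⟩
      obtain ⟨k, hk, -⟩ := exists_hammingNorm_add x e
      -- Adding `e` raises the weight to at most `4m+2`, which is also the minimum weight; `x = e`
      -- is excluded because `4m+1 ≠ 1`.
      have := hmin (x + e) hxe fun h0 => by
        have : x = e := by rw [← word_add_add_cancel x e, h0, zero_add]
        rw [this] at hx
        omega
      omega

theorem hasNonnegIntegerCoeffs_weightEnumerator (s : Set (Word n)) :
    HasNonnegIntegerCoeffs (weightEnumerator s) := fun i => ⟨_, coeff_weightEnumerator s i⟩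

theorem HasNonnegIntegerCoeffs.expand {P : ℚ[X]} (h : ∀ i, ∃ k : ℕ, P.coeff i = k) {p : ℕ}
    (hp : 0 < p) : HasNonnegIntegerCoeffs (expand ℚ p P) := fun i => by
  rw [coeff_expand hp]
  split_ifs
  · exact h _
  · exact ⟨0, by simp⟩

theorem HasNonnegIntegerCoeffs.X_mul {P : ℚ[X]} (h : HasNonnegIntegerCoeffs P) :
    HasNonnegIntegerCoeffs (X * P) := fun i => by
  cases i with
  | zero => exact ⟨0, by simp⟩
  | succ i => rw [coeff_X_mul]; exact h i

theorem IsNormalized.le_of_hasNonnegIntegerCoeffs {m : ℕ} {c : ℕ → ℚ} (hc : IsNormalized m c)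
    (h : HasNonnegIntegerCoeffs (Polynomial.expand ℚ 2 (gleasonPoly (12 * m + 5) (3 * m + 2) c))) :
    m ≤ 159 := by
  by_contra hm
  have h1 := hc.exists_coeff_neg (by omega)
  obtain ⟨k, hk⟩ := h (2 * (2 * m + 4))
  rw [coeff_expand_two] at hk
  rw [hk] at h1
  exact absurd h1 (not_lt.2 (Nat.cast_nonneg k))

end BinaryCode

theorem mainTheorem3 (m : ℕ) (hm : 1 ≤ m) :
    -- the pair of formal weight enumerators exists and is unique
    ∃ W S : ℚ[X], BinaryCode.IsEnumeratorPair m W S ∧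
      (∀ W' S' : ℚ[X], BinaryCode.IsEnumeratorPair m W' S' → W' = W ∧ S' = S) ∧
      -- every actual code and its shadow have these weight enumerators
      (∀ C : Submodule (ZMod 2) (BinaryCode.Word (24 * m + 10)),
        BinaryCode.IsMinimalShadowCode m C →
          BinaryCode.weightEnumerator (C : Set (BinaryCode.Word (24 * m + 10))) = W ∧
          BinaryCode.weightEnumerator (BinaryCode.shadow C) = S) ∧
      -- nonnegativity and integrality hold exactly for `m` up to 159
      ((BinaryCode.HasNonnegIntegerCoeffs W ∧ BinaryCode.HasNonnegIntegerCoeffs S) ↔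
        1 ≤ m ∧ m ≤ 159) ∧
      -- nonexistence
      (160 ≤ m → ¬ ∃ C : Submodule (ZMod 2) (BinaryCode.Word (24 * m + 10)),
        BinaryCode.IsMinimalShadowCode m C) := by
  obtain ⟨c, hc⟩ := BinaryCode.exists_isNormalized hm
  have hp := (BinaryCode.isEnumeratorPair_iff m _ _).2 ⟨c, hc, rfl, rfl⟩
  have hu := fun W' S' (h : BinaryCode.IsEnumeratorPair m W' S') => hp.unique h
  refine ⟨_, _, hp, hu, fun C hC => hu _ _ (hC.isEnumeratorPair hm),
    ⟨fun h => ⟨hm, hc.le_of_hasNonnegIntegerCoeffs h.1⟩, fun h => ?_⟩, ?_⟩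
  · obtain ⟨c', hc', hW, hS⟩ := BinaryCode.exists_isNormalized_of_certificate hm
      (BinaryCode.certificate_eq_true hm h.2)
    obtain ⟨e1, e2⟩ := hu _ _ ((BinaryCode.isEnumeratorPair_iff m _ _).2 ⟨c', hc', rfl, rfl⟩)
    rw [← e1, ← e2]
    exact ⟨.expand hW (by norm_num), .X_mul (.expand hS (by norm_num))⟩
  -- The coefficients of a code's weight enumerator are cardinalities, contradicting the negative
  -- coefficient.
  · rintro h160 ⟨C, hC⟩
    have h := BinaryCode.hasNonnegIntegerCoeffs_weightEnumerator
      (C : Set (BinaryCode.Word (24 * m + 10)))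
    rw [(hu _ _ (hC.isEnumeratorPair hm)).1] at h
    have := hc.le_of_hasNonnegIntegerCoeffs h
    omega
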